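/- **Notation.** Bitstrings are identified with lattice paths (bit $1$ = upstep, bit $0$ = downstep); $\circ$ is concatenation, and $P\circ y$ attaches $y$ to every vertex of a path $P$. $D_{2n}^{=0}(n)$ is the set of lattice paths with $n$ upsteps and $n$ downsteps that never go below $y=0$. $\overline{\mathrm{rev}}(x)$ reverses $x$ and inverts all bits, $\pi(x_1,\dots,x_{2n})=(x_1,x_3,x_2,x_5,x_4,\dots,x_{2n-1},x_{2n-2},x_{2n})$, and $f=\overline{\mathrm{rev}}\circ\pi$ (here composition of maps). $Q_{m}(k,k+1)$ is the graph of bitstrings of length $m$ and weight $k$ or $k+1$, adjacent when they differ in exactly one bit. $F(P),S(P),L(P)$ are the first, second and last vertex of an oriented path $P$. **Paths.** $\mathcal P_2(1,2)=\{(10,11,01)\}$. For $n\ge 1$ and $n+2\le k\le 2n+1$, $\mathcal P_{2n+2}(k,k+1)$ is the union of $\mathcal P_{2n}(k,k+1)\circ 00$, $\mathcal P_{2n}(k-1,k)\circ 10$, $\mathcal P_{2n}(k-1,k)\circ 01$ and $\mathcal P_{2n}(k-2,k-1)\circ 11$, where $\mathcal P_{2n}(j,j+1)=\emptyset$ for $j\ge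 2n$. Moreover $\mathcal P_{2n+2}(n+1,n+2)=\mathcal P_{2n}(n+1,n+2)\circ 00\,\cup\,\mathcal P_{2n}(n,n+1)\circ 10\,\cup\,\mathcal P^*_{2n+2}$, where $\mathcal P^*_{2n+2}$ consists of the paths $g(P',P'')$ for $P',P''\in\mathcal P_{2n}(n,n+1)$ with $L(P')=f(L(P''))$; here $g(P',P'')$ starts at $S(P')\circ 00$, follows $P'\circ 01$ from $S(P')\circ01$ to its end, then $f(P'')\circ 11$ backwards, and ends at $f(F(P''))\circ 01$. **Flippable pairs.** $(P,P')$ is a flippable pair with corresponding flipped pair $(R,R')$ if $P,P'$ are disjoint paths and $R,R'$ are disjoint paths with $V(P)\cup V(P')=V(R)\cup V(R')$, $F(P)=F(R)$, $F(P')=F(R')$, $L(P)=L(R')$ and $L(P')=L(R)$. The set $\mathcal X_{2n}(k,k+1)$ of (unordered) pairs of paths from $\mathcal P_{2n}(k,k+1)$, with associated pairs $(R,R')$ forming the set $\tilde{\mathcal P}_{2n}(k,k+1)$, is defined by: $\mathcal X_2(1,2)=\mathcal X_4(3,4)=\emptyset$; $\mathcal X_4(2,3)$ consists of the pair $P=(1100,1101,0101,0111,0011,1011,1001)$,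 $P'=(1010,1110,0110)$, with $R=(1100,1110,0110)$, $R'=(1010,1011,0011,0111,0101,1101,1001)$; and for $n\ge2$ the recursion of $\mathcal P$ above is applied to pairs and associated pairs, except that in place of $\mathcal P^*_{2n+2}$ one takes all pairs $(g(E,A),g(E',A'))$ with associated pair $(g(E,C'),g(E',C))$, where $(A,A')\in\mathcal X_{2n}(n,n+1)$ has associated pair $(C,C')$ and $E,E'\in\mathcal P_{2n}(n,n+1)$ satisfy $L(E)=f(L(A))$, $L(E')=f(L(A'))$. **Trees and flip vertices.** An ordered rooted tree is encoded by the lattice path obtained from its depth-first traversal from left to right ($1$ = go to the next child, $0$ = return to the parent). $\mathcal T^*_{n,1}$ is the set of trees with $n\geq 3$ edges of the form $1100\circ T'$, and $\tau_1(1100\circ T')=1010\circ T'$. $\mathcal T^*_{n,2}$ is the set of trees with $n$ edges in which the rightmost child $u$ of the leftmost child of the root is a leaf with at least one sibling and the leaf $v$ preceding $u$ from left to right is an only child; $\tau_2$ removes $u$ and makes it a child of $v$. Let $h(())=()$ and $h(1\circ x_\ell\circ 0\circ x_r)=1\circ\pi(h(x_\ell))\circ0\circ h(x_r)$ for lattice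 paths $x_\ell,x_r$ that stay at or above $y=0$ and end on it; this is a bijection of $D_{2n}^{=0}(n)$. Given boolean functions $\mathrm{IsFlipTree}_1$ on $\mathcal T^*_{n,1}$ and $\mathrm{IsFlipTree}_2$ on $\mathcal T^*_{n,2}$, and $x\in D_{2n}^{=0}(n)$, let $T=h^{-1}(x)$; then $\mathrm{IsFlipVertex}(n,x)$ is, in this order of precedence, $\mathrm{IsFlipTree}_1(T)$ if $T\in\mathcal T^*_{n,1}$; $\mathrm{IsFlipTree}_1(\tau_1^{-1}(T))$ if $T\in\tau_1(\mathcal T^*_{n,1})$; $\mathrm{IsFlipTree}_2(T)$ if $T\in\mathcal T^*_{n,2}$; $\mathrm{IsFlipTree}_2(\tau_2^{-1}(T))$ if $T\in\tau_2(\mathcal T^*_{n,2})$; and $\mathrm{false}$ otherwise. **Lemma 3.** Let $n\ge 1$, and let $\mathrm{IsFlipTree}_1$ and $\mathrm{IsFlipTree}_2$ be arbitrary boolean functions on $\mathcal T^*_{n,1}$ and $\mathcal T^*_{n,2}$. (a) For every $x\in D_{2n}^{=0}(n)$ with $\mathrm{IsFlipVertex}(n,x)=\mathrm{true}$ there are $x'\in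 D_{2n}^{=0}(n)$, $x'\ne x$, with $\mathrm{IsFlipVertex}(n,x')=\mathrm{true}$ and paths $P,P'\in\mathcal P_{2n}(n,n+1)$ with $F(P)=x$, $F(P')=x'$ and $(P,P')\in\mathcal X_{2n}(n,n+1)$, such that $(P,P')$ is a flippable pair of paths in $Q_{2n}(n,n+1)$, with a corresponding flipped pair of paths from $\tilde{\mathcal P}_{2n}(n,n+1)$. (b) Consequently the decisions are consistent: for all $(P,P')\in\mathcal X_{2n}(n,n+1)$ we have $\mathrm{IsFlipVertex}(n,F(P))=\mathrm{IsFlipVertex}(n,F(P'))$. -/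

import Mathlib

namespace MiddleLevels

/-! ### Bitstrings and lattice paths

A bitstring is a `List Bool` (`true` is the bit 1, an upstep; `false` is the bit 0, a downstep). -/

/-- Second coordinate of the end point of the lattice path `x`. -/
def height (x : List Bool) : ℤ := (x.count true : ℤ) - (x.count false : ℤ)

/-- `B m k`: the bitstrings of length `m` and weight `k`. -/
def B (m k : ℕ) : Set (List Bool) := {x | x.length = m ∧ x.count true = k}

/-- `D m k`: lattice paths with `k` upsteps and `m - k` downsteps that never move below `y = 0`. -/
def D (m k : ℕ) : Set (List Bool) := {x | x ∈ B m k ∧ ∀ i ≤ m, 0 ≤ height (x.take i)}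

/-- `DZero m k`: the paths in `D m k` that have at least one point `(i, 0)` with `1 ≤ i ≤ m`;
for `m = 0` the empty path is included. -/
def DZero (m k : ℕ) : Set (List Bool) :=
  {x | x ∈ D m k ∧ (m = 0 ∨ ∃ i, 1 ≤ i ∧ i ≤ m ∧ height (x.take i) = 0)}

/-- Reverse the order of the bits and invert every bit. -/
def revBar (x : List Bool) : List Bool := x.reverse.map (fun b => !b)

/-- `(y₁, y₂, y₃, y₄, …) ↦ (y₂, y₁, y₄, y₃, …)`; an unpaired last entry stays fixed. -/
def swapPairs : List Bool → List Bool
  | b :: c :: l => c :: b :: swapPairs l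
  | l => l

/-- `π (x₁, …, x₂ₙ) = (x₁, x₃, x₂, x₅, x₄, …, x₂ₙ₋₁, x₂ₙ₋₂, x₂ₙ)`. -/
def permPi : List Bool → List Bool
  | [] => []
  | a :: l => a :: swapPairs l

/-- The map `revBar ∘ π`. -/
def f (x : List Bool) : List Bool := revBar (permPi x)

/-! ### Oriented paths in the layer graph `Q_m(k, k+1)` -/

/-- An oriented path, given by the sequence of its vertices; `P.head?` and `P.getLast?` are
its first and last vertex. -/
abbrev OPath := List (List Bool)

/-- The two bitstrings have the same length and differ in exactly one bit. -/
def DifferInOneBit (u v : List Bool) : Prop :=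
  u.length = v.length ∧ (u.zip v).countP (fun p => p.1 != p.2) = 1

/-- `P` is an oriented path in the graph `Q_m(k, k+1)`, whose vertex set is `B m k ∪ B m (k+1)`
and whose edges join the bitstrings that differ in exactly one bit. -/
structure IsOrientedPath (m k : ℕ) (P : OPath) : Prop where
  ne_nil : P ≠ []
  mem_layers : ∀ v ∈ P, v ∈ B m k ∪ B m (k + 1)
  adjacent : P.IsChain DifferInOneBit
  nodup : P.Nodup

/-- `P ∘ y`: attach the bitstring `y` to every vertex of `P`. -/
def attach (y : List Bool) (P : OPath) : OPath := P.map (fun v => v ++ y)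

/-- For `P' = (u, v, …)` and `P'' = (a, …)` with `L(P') = f(L(P''))`, the path that starts at
`v ∘ (0,0)`, runs along `P' ∘ (0,1)` from its second vertex `v ∘ (0,1)` to its last vertex, then
traverses `f(P'') ∘ (1,1)` backwards, and ends at `f(a) ∘ (0,1)`. `IsGlued P' P'' Q` says that
`Q` is this path. -/
inductive IsGlued : OPath → OPath → OPath → Prop
  | mk (u v : List Bool) (l : OPath) (a : List Bool) (l' : OPath)
      (h : (u :: v :: l).getLast? = ((a :: l').getLast?).map f) :
      IsGlued (u :: v :: l) (a :: l')
        ((v ++ [false, false]) :: attach [false, true] (v :: l)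
          ++ attach [true, true] ((a :: l').map f).reverse ++ [f a ++ [false, true]])

/-- `paths n k`: the set `𝒫_{2n}(k, k+1)` of oriented paths (empty unless `1 ≤ n ≤ k ≤ 2n - 1`). -/
def paths : ℕ → ℕ → Set OPath
  | 0, _ => ∅
  | 1, k => {P | k = 1 ∧ P = [[true, false], [true, true], [false, true]]}
  | n + 2, k =>
    {Q | k = n + 2 ∧
        ((∃ P ∈ paths (n + 1) (n + 2), Q = attach [false, false] P) ∨
         (∃ P ∈ paths (n + 1) (n + 1), Q = attach [true, false] P) ∨
         (∃ P' ∈ paths (n + 1) (n + 1), ∃ P'' ∈ paths (n + 1) (n + 1), IsGlued P' P'' Q))} ∪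
    {Q | n + 3 ≤ k ∧ k ≤ 2 * n + 3 ∧
        ((∃ P ∈ paths (n + 1) k, Q = attach [false, false] P) ∨
         (∃ P ∈ paths (n + 1) (k - 1), Q = attach [true, false] P) ∨
         (∃ P ∈ paths (n + 1) (k - 1), Q = attach [false, true] P) ∨
         (∃ P ∈ paths (n + 1) (k - 2), Q = attach [true, true] P))}

/-! ### Flippable pairs and flipped pairs -/

/-- `(P, P')` is a flippable pair of paths in `Q_m(k, k+1)` and `(R, R')` is a corresponding
flipped pair: `R, R'` visit the same vertices as `P, P'`, but connect the end vertices the other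
way. -/
structure IsFlippedPair (m k : ℕ) (P P' R R' : OPath) : Prop where
  isPath : IsOrientedPath m k P
  isPath' : IsOrientedPath m k P'
  isPath_flipped : IsOrientedPath m k R
  isPath_flipped' : IsOrientedPath m k R'
  disjoint : P.Disjoint P'
  disjoint_flipped : R.Disjoint R'
  vertices : {v | v ∈ P} ∪ {v | v ∈ P'} = {v | v ∈ R} ∪ {v | v ∈ R'}
  first : P.head? = R.head?
  first' : P'.head? = R'.head?
  last : P.getLast? = R'.getLast?
  last' : P'.getLast? = R.getLast?

/-- The path `(1100, 1101, 0101, 0111, 0011, 1011, 1001)`. -/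
def P₄ : OPath :=
  [[true, true, false, false], [true, true, false, true], [false, true, false, true],
   [false, true, true, true], [false, false, true, true], [true, false, true, true],
   [true, false, false, true]]

/-- The path `(1010, 1110, 0110)`. -/
def P₄' : OPath :=
  [[true, false, true, false], [true, true, true, false], [false, true, true, false]]

/-- The path `(1100, 1110, 0110)`. -/
def R₄ : OPath :=
  [[true, true, false, false], [true, true, true, false], [false, true, true, false]]

/-- The path `(1010, 1011, 0011, 0111, 0101, 1101, 1001)`. -/
def R₄' : OPath :=
  [[true, false, true, false], [true, false, true, true], [false, false, true, true],
   [false, true, true, true], [false, true, false, true], [true, true, false, true],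
   [true, false, false, true]]

/-- `FlipSystem n k P P' R R'`: by the inductive construction, `(P, P')` is one of the chosen
flippable pairs for `𝒫_{2n}(k, k+1)`, and `R`, `R'` are the flipped paths with the same first
vertices as `P` and `P'`, respectively. Pairs are unordered, so both orders occur. -/
def FlipSystem : ℕ → ℕ → OPath → OPath → OPath → OPath → Prop
  | 0, _, _, _, _, _ => False
  | 1, _, _, _, _, _ => False
  | 2, k, P, P', R, R' =>
      k = 2 ∧ ((P = P₄ ∧ P' = P₄' ∧ R = R₄ ∧ R' = R₄') ∨
               (P = P₄' ∧ P' = P₄ ∧ R = R₄' ∧ R' = R₄))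
  | n + 3, k, P, P', R, R' =>
      let ext (j : ℕ) (y : List Bool) : Prop :=
        ∃ A A' C C', FlipSystem (n + 2) j A A' C C' ∧
          P = attach y A ∧ P' = attach y A' ∧ R = attach y C ∧ R' = attach y C'
      (k = n + 3 ∧
        (ext (n + 3) [false, false] ∨ ext (n + 2) [true, false] ∨
          ∃ A A' C C', FlipSystem (n + 2) (n + 2) A A' C C' ∧
            ∃ E ∈ paths (n + 2) (n + 2), ∃ E' ∈ paths (n + 2) (n + 2),
              IsGlued E A P ∧ IsGlued E' A' P' ∧ IsGlued E C' R ∧ IsGlued E' C R')) ∨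
      (n + 4 ≤ k ∧ k ≤ 2 * n + 5 ∧
        (ext k [false, false] ∨ ext (k - 1) [true, false] ∨ ext (k - 1) [false, true] ∨
          ext (k - 2) [true, true]))

/-- The set `𝒳_{2n}(k, k+1)` of flippable pairs for `𝒫_{2n}(k, k+1)`. -/
def flippablePairs (n k : ℕ) : Set (OPath × OPath) :=
  {p | ∃ R R', FlipSystem n k p.1 p.2 R R'}

/-- The set of flipped paths corresponding to the pairs in `𝒳_{2n}(k, k+1)`. -/
def flippedPaths (n k : ℕ) : Set OPath :=
  {R | ∃ P P' R', FlipSystem n k P P' R R'}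

/-! ### Ordered rooted trees -/

/-- Ordered rooted trees: `root` is the tree that has only a root vertex, and `graft s t` arises
from `t` by adding to its root a new leftmost child, which carries the subtree `s`. The
corresponding bitstring is `()` for `root` and `(1) ∘ s ∘ (0) ∘ t` for `graft s t`. -/
inductive OrdTree where
  | root : OrdTree
  | graft (s t : OrdTree) : OrdTree

namespace OrdTree

/-- The number of edges. -/
def edges : OrdTree → ℕ
  | root => 0
  | graft s t => s.edges + 1 + t.edges

/-- `t.addLast s`: add to the root of `t` a new rightmost child, which carries the subtree `s`. -/
def addLast : OrdTree → OrdTree → OrdTree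
  | root, s => graft s root
  | graft a t, s => graft a (t.addLast s)

/-- Remove the rightmost child of the root together with its subtree. -/
def dropLast : OrdTree → OrdTree
  | root => root
  | graft _ root => root
  | graft a (graft b t) => graft a (graft b t).dropLast

/-- Go from the root to the rightmost child as long as possible, and add a child to the leaf
that is reached. -/
def growLast : OrdTree → OrdTree
  | root => graft root root
  | graft a root => graft a.growLast root
  | graft a (graft b t) => graft a (graft b t).growLast

/-- For a tree `w` that hangs below some other vertex: the leaf that is reached from the root
of `w` by always going to the rightmost child is not the root of `w`, and its parent has no other
child (so this parent has degree 2, i.e. the leaf is thin). -/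
inductive LastLeafThin : OrdTree → Prop
  | single : LastLeafThin (graft root root)
  | step (a w : OrdTree) : LastLeafThin w → LastLeafThin (a.addLast w)

/-- The trees with `n` edges, `n ≥ 3`, whose leftmost subtree is a path on two edges. -/
def treesOne (n : ℕ) : Set OrdTree :=
  {T | T.edges = n ∧ 3 ≤ n ∧ ∃ t, T = graft (graft root root) t}

/-- Remove the leaf below the leftmost child of the root and make it the leftmost child of the
root, `(1,1,0,0) ∘ t ↦ (1,0,1,0) ∘ t`; only meaningful on `treesOne n`. -/
def tauOne : OrdTree → OrdTree
  | graft (graft root root) t => graft root (graft root t)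
  | T => T

/-- The trees with `n` edges such that the rightmost child `u` of the leftmost child of the root
is a leaf that has a sibling (so it is a thick leaf), and the clockwise-next leaf of `u`, i.e. the
leaf preceding `u` from left to right, is thin. Here `w` is the subtree carried by the sibling
immediately to the left of `u`, and `a` consists of everything to the left of it. (If `w` is a
single vertex, then the clockwise-next leaf of `u` is a sibling of `u` and thus is thick.) -/
def treesTwo (n : ℕ) : Set OrdTree :=
  {T | T.edges = n ∧
    ∃ a w t : OrdTree, LastLeafThin w ∧ T = graft ((a.addLast w).addLast root) t}

/-- Remove the rightmost child `u` of the leftmost child of the root, and make it a child of its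
clockwise-next leaf; only meaningful on `treesTwo n`. -/
def tauTwo : OrdTree → OrdTree
  | root => root
  | graft s t => graft s.dropLast.growLast t

/-- The mapping `h`: if `T` corresponds to the lattice path `x`, then `h T` is the lattice path
`h(x)`, where `h(()) = ()` and `h((1) ∘ xₗ ∘ (0) ∘ xᵣ) = (1) ∘ π(h(xₗ)) ∘ (0) ∘ h(xᵣ)`. -/
def h : OrdTree → List Bool
  | root => []
  | graft s t => true :: permPi (h s) ++ false :: h t

instance : Nonempty OrdTree := ⟨root⟩

/-- The ordered rooted tree with `n` edges that corresponds to `h⁻¹(x)`. -/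
noncomputable def hInv (n : ℕ) (x : List Bool) : OrdTree :=
  Function.invFunOn h {T | T.edges = n} x

end OrdTree

open OrdTree in
open Classical in
/-- The function `IsFlipVertex(n, x)`, depending on the boolean functions `IsFlipTree₁` and
`IsFlipTree₂`, of which only the values on `treesOne n` and on `treesTwo n` are used. -/
noncomputable def isFlipVertex (isFlipTree₁ isFlipTree₂ : OrdTree → Bool) (n : ℕ)
    (x : List Bool) : Bool :=
  let T := hInv n x
  if T ∈ treesOne n then isFlipTree₁ T
  else if T ∈ tauOne '' treesOne n then isFlipTree₁ (Function.invFunOn tauOne (treesOne n) T)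
  else if T ∈ treesTwo n then isFlipTree₂ T
  else if T ∈ tauTwo '' treesTwo n then isFlipTree₂ (Function.invFunOn tauTwo (treesTwo n) T)
  else false

end MiddleLevels

/-! Everything is read off from the first vertices. By induction, the first, second and last
vertices of a path in `paths n k` are 1∘u∘0∘v, 1∘u∘1∘v and π(u)∘01∘v, where u is a Dyck path and v
stays nonnegative (`exists_hasShape`). Conversely every such 1∘u∘0∘v is a first vertex
(`exists_mem_paths`). Since f(π(p)∘01∘q) = π(revBar q)∘01∘revBar p (`f_last`), each path A has a
partner E with L(E) = f(L(A)), and glueing turns the first vertex x of A into 1∘revBar(x)∘0.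

These first vertices also give, by a simultaneous induction, that all paths are simple and pairwise
disjoint (`paths_isOrientedPath_and_disjoint`). It follows that glueing preserves flippable pairs
(`IsFlippedPair.glued`), so every pair produced by the recursion is flippable
(`FlipSystem.isFlippedPair`). Its first vertices arise from 1100 and 1010 by appending a common tail
and by the operation x ↦ 1∘revBar(x)∘0 (`HeadPair`).

On the tree side, f = revBar∘π gives h(`graft s t`) = 1∘revBar(f(h(s)))∘0∘h(t), which is the same
operation applied to the code f(h(s)) of the leftmost subtree. The first tree transformation
exchanges the prefixes 1100 and 1010 of h(T), and the second exchanges the prefixes 1100 and 1010 of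
that code. So the two transformations are head pairs with zero and with one wrapping, which yields
(a) (`IsTauPair.isFlippableHeads`).

For (b), codes of different kinds show that no tree takes part in two different transformations. A
head pair with at most one wrapping is therefore either a transformation, with equal decisions by
definition, or has value false on both sides. With two or more wrappings the code is too deep for
any transformation, and both decisions are false (`HeadPair.isFlipVertex_eq`). -/

namespace MiddleLevels

/-! ### Nonnegative lattice paths and their decompositions -/

/-- The lattice path `x` leads from height `a` to height `b` and never goes below height `0`. -/
def Walk : ℕ → List Bool → ℕ → Prop
  | a, [], b => a = b
  | a, true :: l, b => Walk (a + 1) l b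
  | 0, false :: _, _ => False
  | a + 1, false :: l, b => Walk a l b

@[simp] theorem walk_nil {a b : ℕ} : Walk a [] b ↔ a = b := by simp [Walk]

@[simp] theorem walk_true {a b : ℕ} {l : List Bool} :
    Walk a (true :: l) b ↔ Walk (a + 1) l b := by simp [Walk]

@[simp] theorem walk_false_zero {b : ℕ} {l : List Bool} : ¬ Walk 0 (false :: l) b := by
  simp [Walk]

@[simp] theorem walk_false_succ {a b : ℕ} {l : List Bool} :
    Walk (a + 1) (false :: l) b ↔ Walk a l b := by simp [Walk]

theorem walk_append {u v : List Bool} {a c : ℕ} :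
    Walk a (u ++ v) c ↔ ∃ b, Walk a u b ∧ Walk b v c := by
  induction u generalizing a with
  | nil => simp
  | cons d u ih =>
    cases d
    · cases a <;> simp [ih]
    · simp [ih]

theorem Walk.append {u v : List Bool} {a b c : ℕ} (hu : Walk a u b) (hv : Walk b v c) :
    Walk a (u ++ v) c := walk_append.2 ⟨b, hu, hv⟩

theorem Walk.add_right {u : List Bool} {a b : ℕ} (hu : Walk a u b) (c : ℕ) :
    Walk (a + c) u (b + c) := by
  induction u generalizing a with
  | nil => simpa using hu
  | cons d u ih =>
    cases d
    · cases a with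
      | zero => simp at hu
      | succ a =>
        rw [Nat.add_right_comm, walk_false_succ]
        exact ih (by simpa using hu)
    · have := ih (by simpa using hu : Walk (a + 1) u b)
      rw [walk_true]
      rwa [Nat.add_right_comm] at this

theorem Walk.count {x : List Bool} {a b : ℕ} (hx : Walk a x b) :
    a + 2 * x.count true = b + x.length := by
  induction x generalizing a with
  | nil => simpa using hx
  | cons d u ih =>
    cases d
    · cases a with
      | zero => simp at hx
      | succ a =>
        have := ih (by simpa using hx)
        simp
        omega
    · have := ih (by simpa using hx : Walk (a + 1) u b)
      simp
      omega

theorem Walk.even_length {x : List Bool} (hx : Walk 0 x 0) : Even x.length := by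
  have := hx.count
  exact ⟨x.count true, by omega⟩

@[simp] theorem revBar_append (u v : List Bool) : revBar (u ++ v) = revBar v ++ revBar u := by
  simp [revBar]

@[simp] theorem revBar_nil : revBar [] = [] := rfl

@[simp] theorem revBar_cons (b : Bool) (v : List Bool) : revBar (b :: v) = revBar v ++ [!b] := by
  simp [revBar]

@[simp] theorem revBar_revBar (x : List Bool) : revBar (revBar x) = x := by
  induction x with
  | nil => rfl
  | cons b x ih => simp [ih]

@[simp] theorem length_revBar (x : List Bool) : (revBar x).length = x.length := by
  simp [revBar]

theorem count_revBar (x : List Bool) : (revBar x).count true + x.count true = x.length := by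
  induction x with
  | nil => rfl
  | cons b x ih => cases b <;> simp <;> omega

theorem Walk.revBar {x : List Bool} {a b : ℕ} (hx : Walk a x b) : Walk b (revBar x) a := by
  induction x generalizing a with
  | nil => simpa using (by simpa using hx : a = b).symm
  | cons d u ih =>
    rw [revBar_cons]
    cases d
    · cases a with
      | zero => simp at hx
      | succ a => exact (ih (by simpa using hx)).append (by simp)
    · exact (ih (by simpa using hx : Walk (a + 1) u b)).append (by simp)

/-- First return: a walk that ends below its start height passes to the height below it. -/
theorem Walk.exists_return {x : List Bool} {a b c : ℕ} (hx : Walk (a + c + 1) x b) (hb : b ≤ c) :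
    ∃ u v, x = u ++ false :: v ∧ Walk a u 0 ∧ Walk c v b := by
  induction x generalizing a with
  | nil => simp at hx; omega
  | cons d x ih =>
    cases d
    · cases a with
      | zero => exact ⟨[], x, rfl, by simp, by simpa using hx⟩
      | succ a =>
        rw [walk_false_succ, Nat.add_right_comm] at hx
        obtain ⟨u, v, rfl, hu, hv⟩ := ih hx
        exact ⟨false :: u, v, rfl, by simpa using hu, hv⟩
    · rw [walk_true, show a + c + 1 + 1 = (a + 1) + c + 1 by omega] at hx
      obtain ⟨u, v, rfl, hu, hv⟩ := ih hx
      exact ⟨true :: u, v, rfl, by simpa using hu, hv⟩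

theorem Walk.exists_decomp {x : List Bool} (hx : Walk 0 x 0) (hne : x ≠ []) :
    ∃ u v, x = true :: u ++ false :: v ∧ Walk 0 u 0 ∧ Walk 0 v 0 := by
  match x with
  | [] => exact absurd rfl hne
  | false :: x => simp at hx
  | true :: x =>
    obtain ⟨u, v, rfl, hu, hv⟩ := Walk.exists_return (a := 0) (c := 0) (b := 0)
      (by simpa using hx) le_rfl
    exact ⟨u, v, by simp, hu, hv⟩

/-- If one of `u`, `u'` were a proper prefix of the other, the longer one would be at height 0 after
this prefix and continue with a downstep. -/
theorem Walk.decomp_unique {u v u' v' : List Bool} (hu : Walk 0 u 0) (hu' : Walk 0 u' 0)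
    (h : u ++ false :: v = u' ++ false :: v') : u = u' ∧ v = v' := by
  rcases List.append_eq_append_iff.1 h with ⟨w, rfl, hw⟩ | ⟨w, rfl, hw⟩
  · cases w with
    | nil => simpa using hw
    | cons d w =>
      obtain ⟨rfl, -⟩ := List.cons_eq_cons.1 hw
      obtain ⟨b, hb, hw'⟩ := walk_append.1 hu'
      have h1 := hu.count
      have h2 := hb.count
      obtain rfl : b = 0 := by omega
      simp at hw'
  · cases w with
    | nil => simpa [eq_comm] using hw
    | cons d w =>
      obtain ⟨rfl, -⟩ := List.cons_eq_cons.1 hw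
      obtain ⟨b, hb, hw'⟩ := walk_append.1 hu
      have h1 := hu'.count
      have h2 := hb.count
      obtain rfl : b = 0 := by omega
      simp at hw'

theorem Walk.exists_middle {x : List Bool} (hx : Walk 0 x 0) (hne : x ≠ []) :
    ∃ m, x = true :: m ++ [false] ∧ Even m.length := by
  have hlen := hx.even_length
  match x with
  | [] => exact absurd rfl hne
  | false :: x => simp at hx
  | true :: x =>
    rcases x.eq_nil_or_concat with rfl | ⟨m, d, rfl⟩
    · simp at hx
    · simp only [List.concat_eq_append] at *
      have hm : Even m.length := by
        simp at hlen
        grind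
      cases d
      · exact ⟨m, rfl, hm⟩
      · have := hx.revBar
        simp at this

theorem walk_wrap {u v : List Bool} {a b : ℕ} (hu : Walk 0 u 0) (hv : Walk a v b) :
    Walk a (true :: u ++ false :: v) b := by
  have := (hu.add_right (a + 1)).append (v := false :: v) (c := b)
    (by rw [Nat.zero_add]; simpa using hv)
  simpa using this

/-! ### The permutation `π` -/

@[simp] theorem swapPairs_nil : swapPairs [] = [] := rfl

@[simp] theorem swapPairs_singleton (a : Bool) : swapPairs [a] = [a] := rfl

@[simp] theorem swapPairs_cons_cons (a b : Bool) (l : List Bool) :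
    swapPairs (a :: b :: l) = b :: a :: swapPairs l := by rw [swapPairs]

@[simp] theorem permPi_nil : permPi [] = [] := rfl

@[simp] theorem permPi_cons (a : Bool) (l : List Bool) : permPi (a :: l) = a :: swapPairs l := rfl

theorem swapPairs_append : ∀ {u : List Bool} (v : List Bool), Even u.length →
    swapPairs (u ++ v) = swapPairs u ++ swapPairs v
  | [], v, _ => rfl
  | [a], v, h => by simp at h
  | a :: b :: u, v, h => by
    have : Even u.length := by simp at h; grind
    simp [swapPairs_append v this]

@[simp] theorem length_swapPairs : ∀ u : List Bool, (swapPairs u).length = u.length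
  | [] => rfl
  | [a] => rfl
  | a :: b :: u => by simp [length_swapPairs u]

@[simp] theorem count_swapPairs : ∀ u : List Bool, (swapPairs u).count true = u.count true
  | [] => rfl
  | [a] => rfl
  | a :: b :: u => by simp [List.count_cons, count_swapPairs u]; omega

@[simp] theorem swapPairs_swapPairs : ∀ u : List Bool, swapPairs (swapPairs u) = u
  | [] => rfl
  | [a] => rfl
  | a :: b :: u => by simp [swapPairs_swapPairs u]

theorem revBar_swapPairs : ∀ {u : List Bool}, Even u.length →
    revBar (swapPairs u) = swapPairs (revBar u)
  | [], _ => rfl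
  | [a], h => by simp at h
  | a :: b :: u, h => by
    have : Even u.length := by simp at h; grind
    simp [swapPairs_append _ (show Even (revBar u).length by simpa), revBar_swapPairs this]

@[simp] theorem length_permPi (u : List Bool) : (permPi u).length = u.length := by
  cases u <;> simp

@[simp] theorem count_permPi (u : List Bool) : (permPi u).count true = u.count true := by
  cases u <;> simp [List.count_cons]

@[simp] theorem permPi_permPi (u : List Bool) : permPi (permPi u) = u := by
  cases u <;> simp

theorem revBar_permPi {u : List Bool} (h : Even u.length) :
    revBar (permPi u) = permPi (revBar u) := by
  match u with
  | [] => rfl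
  | a :: l =>
    rcases l.eq_nil_or_concat with rfl | ⟨m, d, rfl⟩
    · simp at h
    · have hm : Even m.length := by simp at h; grind
      simp [swapPairs_append _ hm, swapPairs_append _ (show Even (revBar m).length by simpa),
        revBar_swapPairs hm]

/-- Only turning an upstep-downstep pair into a downstep-upstep pair can lower the path. Each pair
starts at odd height, hence at height at least 1, so there is room for the downstep. -/
theorem Walk.swapPairs : ∀ {x : List Bool} {a b : ℕ}, Odd a → Walk a x b →
    Walk a (swapPairs x) b
  | [], _, _, _, h => h
  | [_], _, _, _, h => h
  | c :: d :: x, a, b, ha, h => by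
    obtain ⟨m, rfl⟩ := ha
    cases c <;> cases d <;> simp only [swapPairs_cons_cons]
    · rcases m with _ | m
      · rw [show 2 * 0 + 1 = 0 + 1 by rfl, walk_false_succ] at h
        simp at h
      · rw [show 2 * (m + 1) + 1 = 2 * m + 1 + 1 + 1 by ring] at h ⊢
        simp only [walk_false_succ] at h ⊢
        exact Walk.swapPairs ⟨m, rfl⟩ h
    · simp only [walk_false_succ, walk_true] at h ⊢
      exact Walk.swapPairs ⟨m, rfl⟩ h
    · simp only [walk_false_succ, walk_true] at h ⊢
      exact Walk.swapPairs ⟨m, rfl⟩ h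
    · simp only [walk_true] at h ⊢
      exact Walk.swapPairs ⟨m + 1, by ring⟩ h

theorem Walk.permPi {x : List Bool} {b : ℕ} (hx : Walk 0 x b) : Walk 0 (permPi x) b := by
  match x with
  | [] => exact hx
  | false :: x => simp at hx
  | true :: x =>
    simp only [permPi_cons, walk_true] at hx ⊢
    exact hx.swapPairs (by simp)

theorem permPi_wrap {u : List Bool} (v : List Bool) (hu : Even u.length) :
    permPi (true :: u ++ false :: v) = true :: swapPairs u ++ swapPairs (false :: v) := by
  simp [swapPairs_append _ hu]

/-! ### The map `f` -/

theorem f_injective : Function.Injective f := by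
  intro x y hxy
  have := congrArg (fun z => permPi (revBar z)) hxy
  simpa [f] using this

@[simp] theorem length_f (x : List Bool) : (f x).length = x.length := by simp [f]

theorem count_f (x : List Bool) : (f x).count true + x.count true = x.length := by
  have := count_revBar (permPi x)
  simpa [f] using this

theorem Walk.f {x : List Bool} (hx : Walk 0 x 0) : Walk 0 (f x) 0 := hx.permPi.revBar

theorem swapPairs_true_cons {v : List Bool} (hv : Walk 0 v 0) :
    swapPairs (true :: v) = true :: permPi v := by
  match v with
  | [] => rfl
  | false :: v => simp at hv
  | true :: v => simp

/-- Apart from the first entry, the pairs swapped by π lie inside u, or consist of the last bit of u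
and the bit 0 after it, or lie in 1∘v. The middle pair is (0,0) and is unaffected; on 1∘v the swaps
act as π does on v, because v is empty or starts with 1. -/
theorem permPi_last {u v : List Bool} (hu : Walk 0 u 0) (hv : Walk 0 v 0) :
    permPi (permPi u ++ false :: true :: v) = u ++ false :: true :: permPi v := by
  by_cases hne : u = []
  · subst hne
    simp [swapPairs_true_cons hv]
  · obtain ⟨m, rfl, hm⟩ := hu.exists_middle hne
    have hm' : Even (swapPairs m).length := by simpa
    simp [swapPairs_append _ hm, swapPairs_append _ hm', swapPairs_true_cons hv]

theorem f_last {u v : List Bool} (hu : Walk 0 u 0) (hv : Walk 0 v 0) :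
    f (permPi u ++ false :: true :: v) = permPi (revBar v) ++ false :: true :: revBar u := by
  rw [f, permPi_last hu hv]
  simp [revBar_permPi hv.even_length]

/-! ### Bitstrings that differ in one bit -/

theorem differInOneBit_iff {u v : List Bool} : DifferInOneBit u v ↔
    ∃ p s b, u = p ++ b :: s ∧ v = p ++ (!b) :: s := by
  constructor
  · rintro ⟨hl, hc⟩
    induction u generalizing v with
    | nil => simp at hc
    | cons a u ih =>
      cases v with
      | nil => simp at hl
      | cons b v =>
        simp only [List.length_cons, add_left_inj] at hl
        rw [List.zip_cons_cons, List.countP_cons] at hc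
        by_cases hab : a = b
        · subst hab
          obtain ⟨p, s, c, rfl, rfl⟩ := ih hl (by simpa using hc)
          exact ⟨a :: p, s, c, rfl, rfl⟩
        · have h0 : (u.zip v).countP (fun p => p.1 != p.2) = 0 := by simpa [hab] using hc
          have : u = v := by
            clear ih hc
            induction u generalizing v with
            | nil => exact (List.eq_nil_of_length_eq_zero hl.symm).symm
            | cons c u ih =>
              cases v with
              | nil => simp at hl
              | cons d v =>
                rw [List.zip_cons_cons, List.countP_cons] at h0
                obtain rfl : c = d := by
                  by_contra hcd
                  simp [hcd] at h0
                rw [ih v (by simpa using hl) (by omega)]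
          subst this
          exact ⟨[], u, a, rfl, by cases a <;> cases b <;> simp_all⟩
  · rintro ⟨p, s, b, rfl, rfl⟩
    refine ⟨by simp, ?_⟩
    have (l : List Bool) : (l.zip l).countP (fun p => p.1 != p.2) = 0 := by
      induction l with
      | nil => rfl
      | cons a l ih => simp [ih]
    rw [List.zip_append rfl, List.countP_append, this, List.zip_cons_cons, List.countP_cons, this]
    cases b <;> rfl

theorem DifferInOneBit.symm {u v : List Bool} (h : DifferInOneBit u v) : DifferInOneBit v u := by
  obtain ⟨p, s, b, rfl, rfl⟩ := differInOneBit_iff.1 h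
  exact differInOneBit_iff.2 ⟨p, s, !b, rfl, by simp⟩

theorem DifferInOneBit.append {u v : List Bool} (h : DifferInOneBit u v) (y : List Bool) :
    DifferInOneBit (u ++ y) (v ++ y) := by
  obtain ⟨p, s, b, rfl, rfl⟩ := differInOneBit_iff.1 h
  exact differInOneBit_iff.2 ⟨p, s ++ y, b, by simp, by simp⟩

theorem DifferInOneBit.cons {u v : List Bool} (h : DifferInOneBit u v) (a : Bool) :
    DifferInOneBit (a :: u) (a :: v) := by
  obtain ⟨p, s, b, rfl, rfl⟩ := differInOneBit_iff.1 h
  exact differInOneBit_iff.2 ⟨a :: p, s, b, by simp, by simp⟩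

theorem DifferInOneBit.revBar {u v : List Bool} (h : DifferInOneBit u v) :
    DifferInOneBit (revBar u) (revBar v) := by
  obtain ⟨p, s, b, rfl, rfl⟩ := differInOneBit_iff.1 h
  exact differInOneBit_iff.2 ⟨MiddleLevels.revBar s, MiddleLevels.revBar p, !b, by simp, by simp⟩

theorem differInOneBit_head {b c : Bool} (h : b ≠ c) (s : List Bool) :
    DifferInOneBit (b :: s) (c :: s) :=
  differInOneBit_iff.2 ⟨[], s, b, rfl, by cases b <;> cases c <;> simp_all⟩

theorem DifferInOneBit.swapPairs : ∀ {u v : List Bool}, DifferInOneBit u v →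
    DifferInOneBit (swapPairs u) (swapPairs v) := by
  intro u v h
  obtain ⟨p, s, b, rfl, rfl⟩ := differInOneBit_iff.1 h
  clear h
  suffices H : ∀ (n : ℕ) (p s : List Bool) (b : Bool), p.length = n → DifferInOneBit
      (MiddleLevels.swapPairs (p ++ b :: s)) (MiddleLevels.swapPairs (p ++ (!b) :: s)) from
    H _ p s b rfl
  intro n
  induction n using Nat.strong_induction_on with
  | _ n ih =>
    intro p s b hp
    match p with
    | [] =>
      cases s with
      | nil => exact differInOneBit_head (by simp) _
      | cons c s => exact (differInOneBit_head (by simp) _).cons c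
    | [a] => exact differInOneBit_head (by simp) _
    | a :: c :: p =>
      exact ((ih p.length (by simp at hp; omega) p s b rfl).cons a).cons c

theorem DifferInOneBit.permPi {u v : List Bool} (h : DifferInOneBit u v) :
    DifferInOneBit (permPi u) (permPi v) := by
  obtain ⟨p, s, b, rfl, rfl⟩ := differInOneBit_iff.1 h
  cases p with
  | nil => exact differInOneBit_head (by simp) _
  | cons a p =>
    exact (DifferInOneBit.swapPairs (differInOneBit_iff.2 ⟨p, s, b, rfl, rfl⟩)).cons a

theorem DifferInOneBit.f {u v : List Bool} (h : DifferInOneBit u v) :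
    DifferInOneBit (f u) (f v) := h.permPi.revBar

/-! ### Attaching bits and glueing -/

theorem mem_attach {y w : List Bool} {P : OPath} : w ∈ attach y P ↔ ∃ v ∈ P, w = v ++ y := by
  simp [attach, eq_comm]

theorem head?_attach (y : List Bool) (P : OPath) :
    (attach y P).head? = P.head?.map (· ++ y) := by simp [attach]

theorem getLast?_attach (y : List Bool) (P : OPath) :
    (attach y P).getLast? = P.getLast?.map (· ++ y) := by simp [attach]

theorem attach_disjoint {y : List Bool} {P P' : OPath} (h : P.Disjoint P') :
    (attach y P).Disjoint (attach y P') := by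
  intro w hw hw'
  obtain ⟨v, hv, rfl⟩ := mem_attach.1 hw
  obtain ⟨v', hv', e⟩ := mem_attach.1 hw'
  obtain rfl := List.append_cancel_right e
  exact h hv hv'

theorem attach_disjoint_of_ne {y z : List Bool} (hyz : y.length = z.length) (hne : y ≠ z)
    (P P' : OPath) : (attach y P).Disjoint (attach z P') := by
  intro w hw hw'
  obtain ⟨v, hv, rfl⟩ := mem_attach.1 hw
  obtain ⟨v', hv', e⟩ := mem_attach.1 hw'
  exact hne (List.append_inj' e hyz).2

theorem IsOrientedPath.attach {m k : ℕ} {P : OPath} (h : IsOrientedPath m k P) (y : List Bool) :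
    IsOrientedPath (m + y.length) (k + y.count true) (attach y P) where
  ne_nil := by simpa [MiddleLevels.attach] using h.ne_nil
  mem_layers := by
    intro w hw
    obtain ⟨v, hv, rfl⟩ := mem_attach.1 hw
    have := h.mem_layers v hv
    simp only [B, Set.mem_union, Set.mem_ofPred_eq, List.length_append, List.count_append] at this ⊢
    omega
  adjacent := by
    rw [MiddleLevels.attach, List.isChain_map]
    exact h.adjacent.imp fun _ _ hab => hab.append y
  nodup := h.nodup.map fun _ _ e => List.append_cancel_right e

theorem IsGlued.mem_iff {E A Q : OPath} (hg : IsGlued E A Q) {w : List Bool} :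
    w ∈ Q ↔ (∃ s, E.tail.head? = some s ∧ w = s ++ [false, false]) ∨
      (∃ e ∈ E.tail, w = e ++ [false, true]) ∨ (∃ a ∈ A, w = f a ++ [true, true]) ∨
      ∃ a, A.head? = some a ∧ w = f a ++ [false, true] := by
  obtain ⟨u, v, l, a, l', h⟩ := hg
  simp only [List.mem_append, List.mem_cons, mem_attach, List.mem_reverse, List.mem_map,
    List.tail_cons, List.head?_cons, Option.some.injEq, List.not_mem_nil, or_false]
  constructor
  · rintro (((rfl | ⟨e, he, rfl⟩) | ⟨_, ⟨b, hb, rfl⟩, rfl⟩) | rfl)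
    · exact .inl ⟨v, rfl, rfl⟩
    · exact .inr (.inl ⟨e, he, rfl⟩)
    · exact .inr (.inr (.inl ⟨b, hb, rfl⟩))
    · exact .inr (.inr (.inr ⟨a, rfl, rfl⟩))
  · rintro (⟨s, rfl, rfl⟩ | ⟨e, he, rfl⟩ | ⟨b, hb, rfl⟩ | ⟨_, rfl, rfl⟩)
    · exact .inl (.inl (.inl rfl))
    · exact .inl (.inl (.inr ⟨e, he, rfl⟩))
    · exact .inl (.inr ⟨f b, ⟨b, hb, rfl⟩, rfl⟩)
    · exact .inr rfl

theorem IsGlued.head? {E A Q : OPath} (hg : IsGlued E A Q) :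
    Q.head? = E.tail.head?.map (· ++ [false, false]) := by
  obtain ⟨u, v, l, a, l', h⟩ := hg
  rfl

theorem IsGlued.getLast? {E A Q : OPath} (hg : IsGlued E A Q) :
    Q.getLast? = A.head?.map (fun a => f a ++ [false, true]) := by
  obtain ⟨u, v, l, a, l', h⟩ := hg
  exact List.getLast?_concat

theorem IsGlued.getLast?_eq {E A Q : OPath} (hg : IsGlued E A Q) :
    E.getLast? = A.getLast?.map f := by
  obtain ⟨u, v, l, a, l', h⟩ := hg
  exact h

/-- The last two bits separate the pieces of the glued path, except that 01 ends both the part along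
`E` and the final vertex; `f a ∉ E.tail` excludes that collision. The weight conditions put the two
extreme vertices into the right layers, and at each junction only one of the two attached bits
changes. -/
theorem IsGlued.isOrientedPath {m : ℕ} {E A Q : OPath} (hg : IsGlued E A Q)
    (hE : IsOrientedPath (2 * m) m E) (hA : IsOrientedPath (2 * m) m A)
    (hS : ∀ s, E.tail.head? = some s → s.count true = m + 1)
    (hF : ∀ a, A.head? = some a → a.count true = m ∧ f a ∉ E.tail) :
    IsOrientedPath (2 * (m + 1)) (m + 1) Q where
  ne_nil := by
    obtain ⟨u, v, l, a, l', h⟩ := hg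
    simp
  mem_layers := by
    have hv : ∀ (v : List Bool) (b c : Bool), v ++ [b, c] ∈
        B (2 * (m + 1)) (m + 1) ∪ B (2 * (m + 1)) (m + 1 + 1) ↔ v.length = 2 * m ∧
          (v.count true + [b, c].count true = m + 1 ∨
            v.count true + [b, c].count true = m + 2) := by
      intro v b c
      simp only [B, Set.mem_union, Set.mem_ofPred_eq, List.length_append, List.count_append,
        List.length_cons, List.length_nil]
      omega
    have hEB : ∀ e ∈ E, e.length = 2 * m ∧ (e.count true = m ∨ e.count true = m + 1) := by
      intro e he
      have := hE.mem_layers e he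
      simp only [B, Set.mem_union, Set.mem_ofPred_eq] at this
      omega
    have hfa : ∀ a ∈ A, a.length = 2 * m ∧ (f a).count true + a.count true = 2 * m ∧
        (a.count true = m ∨ a.count true = m + 1) := by
      intro a ha
      have h1 := hA.mem_layers a ha
      have h2 := count_f a
      simp only [B, Set.mem_union, Set.mem_ofPred_eq] at h1
      omega
    intro w hw
    rcases hg.mem_iff.1 hw with (⟨s, hs, rfl⟩ | ⟨e, he, rfl⟩ | ⟨b, hb, rfl⟩ | ⟨b, hb, rfl⟩) <;>
      rw [hv]
    · have h1 := hEB s (List.mem_of_mem_tail (List.mem_of_mem_head? hs))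
      have h2 := hS s hs
      exact ⟨h1.1, .inl (by simpa using h2)⟩
    · have := hEB e (List.mem_of_mem_tail he)
      simp
      omega
    · have := hfa b hb
      simp
      omega
    · have h1 := hfa b (List.mem_of_mem_head? hb)
      have h2 := hF b hb
      simp
      omega
  adjacent := by
    have hEc := hE.adjacent
    have hAc := hA.adjacent
    obtain ⟨u, v, l, a, l', h⟩ := hg
    have key : ∀ w : List Bool, DifferInOneBit (w ++ [false, true]) (w ++ [true, true]) :=
      fun w => differInOneBit_iff.2 ⟨w, [true], false, rfl, rfl⟩
    rw [List.isChain_append, List.isChain_append, List.isChain_cons, attach, List.isChain_map,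
      attach, List.isChain_map, List.isChain_reverse, List.isChain_map]
    refine ⟨⟨⟨?_, ?_⟩, ?_, ?_⟩, by simp, ?_⟩
    · simp only [List.map_cons, List.head?_cons, Option.mem_some_iff]
      rintro _ rfl
      exact differInOneBit_iff.2 ⟨v ++ [false], [], false, by simp, by simp⟩
    · exact hEc.tail.imp fun _ _ e => e.append _
    · exact hAc.imp fun _ _ e => (e.f.append _).symm
    · intro x hx y hy
      rw [List.getLast?_cons_cons] at h
      rw [List.map_cons, List.getLast?_cons_cons, ← List.map_cons (f := fun w => w ++ [false, true]), List.getLast?_map, h] at hx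
      rw [List.head?_map, List.head?_reverse, List.getLast?_map] at hy
      cases hlast : (a :: l').getLast? with
      | none => simp [hlast] at hx
      | some b =>
        rw [hlast] at hx hy
        simp at hx hy
        rw [← hx, ← hy]
        exact key _
    · intro x hx y hy
      rw [List.map_cons (f := f), List.reverse_cons, List.map_append, ← List.append_assoc,
        List.map_singleton, List.getLast?_concat] at hx
      obtain rfl : f a ++ [true, true] = x := by simpa using hx
      obtain rfl : f a ++ [false, true] = y := by simpa using hy
      exact (key _).symm
  nodup := by
    have hEn := hE.nodup
    have hAn := hA.nodup
    obtain ⟨u, v, l, a, l', h⟩ := hg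
    have ha := (hF a rfl).2
    rw [List.nodup_append', List.nodup_append', List.nodup_cons]
    refine ⟨⟨⟨?_, ?_⟩, ?_, ?_⟩, by simp, ?_⟩
    · intro hv
      obtain ⟨w, -, hw⟩ := mem_attach.1 hv
      simpa using (List.append_inj' hw rfl).2
    · exact hEn.tail.map fun _ _ e => List.append_cancel_right e
    · exact (List.nodup_reverse.2 (hAn.map f_injective)).map
        fun _ _ e => List.append_cancel_right e
    · intro w hw hw'
      obtain ⟨b, -, rfl⟩ := mem_attach.1 hw'
      rcases List.mem_cons.1 hw with hw | hw
      · simpa using (List.append_inj' hw rfl).2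
      · obtain ⟨c, -, hc⟩ := mem_attach.1 hw
        simpa using (List.append_inj' hc rfl).2
    · intro w hw hw'
      obtain rfl : w = f a ++ [false, true] := by simpa using hw'
      rcases List.mem_append.1 hw with hw | hw
      · rcases List.mem_cons.1 hw with hw | hw
        · simpa using (List.append_inj' hw rfl).2
        · obtain ⟨c, hc, e⟩ := mem_attach.1 hw
          exact ha (List.append_cancel_right e ▸ hc)
      · obtain ⟨c, -, hc⟩ := mem_attach.1 hw
        simpa using (List.append_inj' hc rfl).2

theorem IsGlued.disjoint {E A Q E' A' Q' : OPath} (hg : IsGlued E A Q) (hg' : IsGlued E' A' Q')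
    (hE : E.Disjoint E') (hA : A.Disjoint A')
    (hF : ∀ a, A.head? = some a → f a ∉ E'.tail) (hF' : ∀ a, A'.head? = some a → f a ∉ E.tail) :
    Q.Disjoint Q' := by
  intro w hw hw'
  have key (u v : List Bool) (a b c d : Bool) : u ++ [a, b] = v ++ [c, d] →
      u = v ∧ a = c ∧ b = d := by
    intro e
    simpa using List.append_inj' e rfl
  rcases hg.mem_iff.1 hw with (⟨s, hs, rfl⟩ | ⟨e, he, rfl⟩ | ⟨b, hb, rfl⟩ | ⟨b, hb, rfl⟩) <;>
  rcases hg'.mem_iff.1 hw' with (⟨s', hs', e'⟩ | ⟨s', hs', e'⟩ | ⟨s', hs', e'⟩ | ⟨s', hs', e'⟩) <;>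
  obtain ⟨h1, h2, h3⟩ := key _ _ _ _ _ _ e' <;>
  (first
  | exact absurd h2 (by decide)
  | exact absurd h3 (by decide)
  | skip)
  · subst h1
    exact hE (List.mem_of_mem_tail (List.mem_of_mem_head? hs))
      (List.mem_of_mem_tail (List.mem_of_mem_head? hs'))
  · subst h1
    exact hE (List.mem_of_mem_tail he) (List.mem_of_mem_tail hs')
  · subst h1
    exact hF' _ hs' he
  · obtain rfl := f_injective h1
    exact hA hb hs'
  · subst h1
    exact hF _ hb hs'
  · obtain rfl := f_injective h1
    exact hA (List.mem_of_mem_head? hb) (List.mem_of_mem_head? hs')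

/-! ### The recursion for the paths -/

/-- `y` consists of two bits, and walks from the end height of the first vertices of
`paths (n + 1) j` to that of the first vertices of `paths (n + 2) k`. -/
def IsExtension (n j k : ℕ) (y : List Bool) : Prop :=
  y.length = 2 ∧ ∃ b c, Walk b y c ∧ b + 2 * (n + 1) = 2 * j ∧ c + 2 * (n + 2) = 2 * k

theorem isExtension_ff {n j k : ℕ} :
    IsExtension n j k [false, false] ↔ j = k ∧ n + 2 ≤ k := by
  constructor
  · rintro ⟨-, b, c, h, h1, h2⟩
    have := h.count
    simp at this
    omega
  · rintro ⟨rfl, h⟩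
    exact ⟨rfl, 2 * (j - n - 2) + 1 + 1, 2 * (j - n - 2), by simp, by omega, by omega⟩

theorem isExtension_tf {n j k : ℕ} :
    IsExtension n j k [true, false] ↔ j + 1 = k ∧ n + 2 ≤ k := by
  constructor
  · rintro ⟨-, b, c, h, h1, h2⟩
    have := h.count
    simp at this
    omega
  · rintro ⟨rfl, h⟩
    exact ⟨rfl, 2 * (j - n - 1), 2 * (j - n - 1), by simp, by omega, by omega⟩

theorem isExtension_ft {n j k : ℕ} :
    IsExtension n j k [false, true] ↔ j + 1 = k ∧ n + 3 ≤ k := by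
  constructor
  · rintro ⟨-, b, c, h, h1, h2⟩
    have := h.count
    cases b with
    | zero => simp at h
    | succ b => simp at this; omega
  · rintro ⟨rfl, h⟩
    exact ⟨rfl, 2 * (j - n - 2) + 1 + 1, 2 * (j - n - 2) + 1 + 1, by simp, by omega, by omega⟩

theorem isExtension_tt {n j k : ℕ} :
    IsExtension n j k [true, true] ↔ j + 2 = k ∧ n + 3 ≤ k := by
  constructor
  · rintro ⟨-, b, c, h, h1, h2⟩
    have := h.count
    simp at this
    omega
  · rintro ⟨rfl, h⟩
    exact ⟨rfl, 2 * (j - n - 1), 2 * (j - n - 1) + 1 + 1, by simp, by omega, by omega⟩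

theorem IsExtension.cases {n j k : ℕ} {y : List Bool} (h : IsExtension n j k y) :
    y = [false, false] ∨ y = [true, false] ∨ y = [false, true] ∨ y = [true, true] := by
  obtain ⟨a, b, rfl⟩ := List.length_eq_two.1 h.1
  cases a <;> cases b <;> simp

theorem IsExtension.count {n j k : ℕ} {y : List Bool} (h : IsExtension n j k y) :
    j + y.count true = k := by
  obtain ⟨hl, b, c, h, h1, h2⟩ := h
  have := h.count
  omega

theorem paths_add_two (n k : ℕ) : paths (n + 2) k =
    {Q | k = n + 2 ∧
        ((∃ P ∈ paths (n + 1) (n + 2), Q = attach [false, false] P) ∨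
         (∃ P ∈ paths (n + 1) (n + 1), Q = attach [true, false] P) ∨
         (∃ P' ∈ paths (n + 1) (n + 1), ∃ P'' ∈ paths (n + 1) (n + 1), IsGlued P' P'' Q))} ∪
    {Q | n + 3 ≤ k ∧ k ≤ 2 * n + 3 ∧
        ((∃ P ∈ paths (n + 1) k, Q = attach [false, false] P) ∨
         (∃ P ∈ paths (n + 1) (k - 1), Q = attach [true, false] P) ∨
         (∃ P ∈ paths (n + 1) (k - 1), Q = attach [false, true] P) ∨
         (∃ P ∈ paths (n + 1) (k - 2), Q = attach [true, true] P))} := by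
  rw [paths]

theorem paths_bounds {n k : ℕ} {P : OPath} (hP : P ∈ paths n k) : n ≤ k ∧ k + 1 ≤ 2 * n := by
  match n with
  | 0 => simp [paths] at hP
  | 1 =>
    obtain ⟨rfl, -⟩ := hP
    omega
  | n + 2 =>
    rw [paths_add_two] at hP
    rcases hP with ⟨rfl, -⟩ | ⟨h1, h2, -⟩ <;> omega

/-- Phrasing the attached bits as a walk between the end heights merges the cases k = n + 2 and k >
n + 2: at k = n + 2 the walk condition rules out exactly 01 and 11. The upper bound on k is
automatic by `paths_bounds`. -/
theorem mem_paths_add_two {n k : ℕ} {Q : OPath} : Q ∈ paths (n + 2) k ↔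
    (k = n + 2 ∧ ∃ E ∈ paths (n + 1) (n + 1), ∃ A ∈ paths (n + 1) (n + 1), IsGlued E A Q) ∨
      ∃ j y, IsExtension n j k y ∧ ∃ P ∈ paths (n + 1) j, Q = attach y P := by
  rw [paths_add_two]
  constructor
  · rintro (⟨rfl, h | h | h⟩ | ⟨h1, h2, h | h | h | h⟩)
    · exact .inr ⟨_, _, isExtension_ff.2 ⟨rfl, le_rfl⟩, h⟩
    · exact .inr ⟨_, _, isExtension_tf.2 ⟨rfl, le_rfl⟩, h⟩
    · exact .inl ⟨rfl, h⟩
    · exact .inr ⟨_, _, isExtension_ff.2 ⟨rfl, by omega⟩, h⟩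
    · exact .inr ⟨_, _, isExtension_tf.2 ⟨by omega, by omega⟩, h⟩
    · exact .inr ⟨_, _, isExtension_ft.2 ⟨by omega, by omega⟩, h⟩
    · exact .inr ⟨_, _, isExtension_tt.2 ⟨by omega, by omega⟩, h⟩
  · rintro (⟨rfl, h⟩ | ⟨j, y, hy, h⟩)
    · exact .inl ⟨rfl, .inr (.inr h)⟩
    · have hb := paths_bounds h.choose_spec.1
      rcases hy.cases with rfl | rfl | rfl | rfl
      · obtain ⟨rfl, h1⟩ := isExtension_ff.1 hy
        rcases h1.eq_or_lt with rfl | h1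
        · exact .inl ⟨rfl, .inl h⟩
        · exact .inr ⟨h1, by omega, .inl h⟩
      · obtain ⟨rfl, h1⟩ := isExtension_tf.1 hy
        rcases h1.eq_or_lt with h1 | h1
        · obtain rfl : j = n + 1 := by omega
          exact .inl ⟨rfl, .inr (.inl h)⟩
        · exact .inr ⟨h1, by omega, .inr (.inl h)⟩
      · obtain ⟨rfl, h1⟩ := isExtension_ft.1 hy
        exact .inr ⟨h1, by omega, .inr (.inr (.inl h))⟩
      · obtain ⟨rfl, h1⟩ := isExtension_tt.1 hy
        exact .inr ⟨h1, by omega, .inr (.inr (.inr h))⟩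

/-! ### First, second and last vertices -/

/-- The first, second and last vertex of `P` are `1 ∘ u ∘ 0 ∘ v`, `1 ∘ u ∘ 1 ∘ v` and
`π(u) ∘ 01 ∘ v`. -/
structure HasShape (P : OPath) (u v : List Bool) : Prop where
  head : P.head? = some (true :: u ++ false :: v)
  second : P.tail.head? = some (true :: u ++ true :: v)
  last : P.getLast? = some (permPi u ++ false :: true :: v)

theorem HasShape.attach {P : OPath} {u v : List Bool} (h : HasShape P u v) (y : List Bool) :
    HasShape (attach y P) u (v ++ y) where
  head := by simp [head?_attach, h.head]
  second := by
    have := h.second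
    simp only [MiddleLevels.attach, ← List.map_tail, List.head?_map]
    rw [this]
    simp
  last := by simp [getLast?_attach, h.last]

/-- By `f_last` and unique decomposition, L(E) = f(L(A)) determines both parts of `E` from those of
`A`. The second vertex of `E` followed by 00 is then 1∘revBar(F(A))∘0. -/
theorem HasShape.isGlued {E A Q : OPath} (hg : IsGlued E A Q) {u v p q : List Bool}
    (hE : HasShape E u v) (hA : HasShape A p q) (hu : Walk 0 u 0)
    (hp : Walk 0 p 0) (hq : Walk 0 q 0) :
    u = revBar q ∧ v = revBar p ∧
      HasShape Q (revBar (true :: p ++ false :: q)) [] := by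
  have h := hg.getLast?_eq
  rw [hE.last, hA.last, Option.map_some, Option.some_inj, f_last hp hq] at h
  obtain ⟨h1, h2⟩ := hu.permPi.decomp_unique hq.revBar.permPi h
  have h1' : u = revBar q := by simpa using congrArg permPi h1
  have h2' : v = revBar p := by simpa using h2
  refine ⟨h1', h2', ?_⟩
  have hs : HasShape Q (u ++ true :: v ++ [false]) [] := by
    constructor
    · simp [hg.head?, hE.second]
    · have := hE.second
      obtain ⟨a, b, l, c, l', h⟩ := hg
      obtain rfl : b = _ := by simpa using this
      simp [MiddleLevels.attach]
    · have hw : Even (true :: p ++ false :: q).length := by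
        have := hp.even_length
        have := hq.even_length
        simp
        grind
      rw [hg.getLast?, hA.head, Option.map_some, f, revBar_permPi hw]
      simp [h1', h2']
  simpa [h1', h2'] using hs

theorem exists_hasShape {n k : ℕ} {P : OPath} (hP : P ∈ paths n k) :
    ∃ u v b, HasShape P u v ∧ Walk 0 u 0 ∧ Walk 0 v b ∧ b + 2 * n = 2 * k ∧
      u.length + v.length + 2 = 2 * n := by
  induction n generalizing k P with
  | zero => simp [paths] at hP
  | succ n ih =>
    cases n with
    | zero =>
      obtain ⟨rfl, rfl⟩ := hP
      exact ⟨[], [], 0, ⟨rfl, rfl, rfl⟩, by simp, by simp, rfl, rfl⟩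
    | succ n =>
      rcases mem_paths_add_two.1 hP with ⟨rfl, E, hE, A, hA, hg⟩ | ⟨j, y, hy, P', hP', rfl⟩
      · obtain ⟨u, v, b, hs, hu, hv, hb, hl⟩ := ih hE
        obtain ⟨p, q, c, hs', hp, hq, hc, hl'⟩ := ih hA
        obtain rfl : c = 0 := by omega
        obtain ⟨rfl, rfl, h⟩ := HasShape.isGlued hg hs hs' hu hp hq
        refine ⟨_, _, 0, h, (walk_wrap hp hq).revBar, by simp, by omega, ?_⟩
        simp
        omega
      · obtain ⟨u, v, b, hs, hu, hv, hb, hl⟩ := ih hP'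
        obtain ⟨hl2, b', c, hw, hb', hc⟩ := hy
        obtain rfl : b = b' := by omega
        refine ⟨u, v ++ y, c, hs.attach y, hu, hv.append hw, by omega, ?_⟩
        simp
        omega

theorem HasShape.unique {P : OPath} {u v u' v' : List Bool} (h : P.head? = some
    (true :: u' ++ false :: v')) (hs : HasShape P u v) (hu : Walk 0 u 0) (hu' : Walk 0 u' 0) :
    u = u' ∧ v = v' := by
  rw [hs.head] at h
  exact hu.decomp_unique hu' (by simpa using h)

theorem exists_isGlued {E A : OPath} {u v : List Bool} (hE : HasShape E u v) (hA : A ≠ [])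
    (h : E.getLast? = A.getLast?.map f) : ∃ Q, IsGlued E A Q := by
  match E, A, hA with
  | u :: v :: l, a :: l', _ => exact ⟨_, .mk u v l a l' h⟩
  | [_], _, _ => simpa using hE.second
  | [], _, _ => simpa using hE.head

/-- Every path `A` has a partner `E` with `L(E) = f(L(A))`, and it can be glued to every path
with the same last vertex as `A`. -/
theorem exists_partner_of_exists {n : ℕ} (H : ∀ u v, Walk 0 u 0 → Walk 0 v 0 →
      u.length + v.length + 2 = 2 * n → ∃ P ∈ paths n n, P.head? = some (true :: u ++ false :: v))
    {A : OPath} (hA : A ∈ paths n n) : ∃ E ∈ paths n n, E.getLast? = A.getLast?.map f ∧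
      ∀ C : OPath, C.getLast? = A.getLast? → ∃ Q, IsGlued E C Q := by
  obtain ⟨p, q, c, hA', hp, hq, hc, hl⟩ := exists_hasShape hA
  obtain rfl : c = 0 := by omega
  obtain ⟨E, hE, hh⟩ := H (revBar q) (revBar p) hq.revBar hp.revBar (by simp; omega)
  obtain ⟨u, v, b, hE', hu, hv, hb, -⟩ := exists_hasShape hE
  obtain ⟨rfl, rfl⟩ := hE'.unique hh hu hq.revBar
  have hlast : E.getLast? = A.getLast?.map f := by
    rw [hE'.last, hA'.last, Option.map_some, f_last hp hq]
  refine ⟨E, hE, hlast, fun C hC => exists_isGlued hE' ?_ (hC ▸ hlast)⟩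
  rintro rfl
  simp [hA'.last] at hC

theorem exists_mem_paths {n k b : ℕ} {u v : List Bool} (hu : Walk 0 u 0) (hv : Walk 0 v b)
    (hb : b + 2 * n = 2 * k) (hl : u.length + v.length + 2 = 2 * n) :
    ∃ P ∈ paths n k, P.head? = some (true :: u ++ false :: v) := by
  induction n generalizing k b u v with
  | zero => omega
  | succ n ih =>
    cases n with
    | zero =>
      obtain rfl : u = [] := List.eq_nil_of_length_eq_zero (by omega)
      obtain rfl : v = [] := List.eq_nil_of_length_eq_zero (by omega)
      obtain rfl : 0 = b := by simpa using hv
      exact ⟨_, ⟨by omega, rfl⟩, rfl⟩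
    | succ n =>
      -- An empty v forces a glued path, where u = revBar(F(A)) dictates the first vertex of `A`.
      -- Otherwise the last two bits of v are an extension.
      by_cases hne : v = []
      · subst hne
        obtain rfl : 0 = b := by simpa using hv
        obtain rfl : k = n + 2 := by omega
        obtain ⟨p, q, hpq, hp, hq⟩ := hu.revBar.exists_decomp (by
          intro h
          have := congrArg List.length h
          simp at this hl
          subst this
          simp at hl)
        have hpl := congrArg List.length hpq
        simp at hpl hl
        obtain ⟨A, hA, hh⟩ := ih (k := n + 1) hp hq (by omega) (by omega)
        obtain ⟨E, hE, hEA, H⟩ := exists_partner_of_exists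
          (fun u v hu hv hl => ih hu hv (by omega) hl) hA
        obtain ⟨Q, hg⟩ := H A rfl
        obtain ⟨u', v', b, hE', hu', hv', hb, -⟩ := exists_hasShape hE
        obtain ⟨p', q', c, hA', hp', hq', hc, -⟩ := exists_hasShape hA
        obtain rfl : c = 0 := by omega
        obtain ⟨rfl, rfl⟩ := hA'.unique hh hp' hp
        refine ⟨Q, mem_paths_add_two.2 (.inl ⟨rfl, E, hE, A, hA, hg⟩), ?_⟩
        rw [(HasShape.isGlued hg hE' hA' hu' hp hq).2.2.head, ← hpq, revBar_revBar]
      · obtain ⟨v', y, rfl, hy⟩ : ∃ v' y, v = v' ++ y ∧ y.length = 2 := by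
          have := hu.even_length
          have : 2 ≤ v.length := by
            have := List.length_pos_iff.2 hne
            grind
          exact ⟨v.take (v.length - 2), v.drop (v.length - 2), by simp, by simp; omega⟩
        obtain ⟨c, hv', hy'⟩ := walk_append.1 hv
        have h1 := hy'.count
        simp at hl
        have h2 := hv'.count
        have h3 := hv.count
        simp at h3
        obtain ⟨P, hP, hh⟩ := ih (k := k - y.count true) hu hv' (by omega) (by omega)
        exact ⟨attach y P, mem_paths_add_two.2 (.inr ⟨_, y, ⟨hy, c, b, hy', by omega, by omega⟩,
          P, hP, rfl⟩), by simp [head?_attach, hh]⟩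

theorem exists_partner {n : ℕ} {A : OPath} (hA : A ∈ paths n n) :
    ∃ E ∈ paths n n, E.getLast? = A.getLast?.map f ∧
      ∀ C : OPath, C.getLast? = A.getLast? → ∃ Q, IsGlued E C Q :=
  exists_partner_of_exists (fun _ _ hu hv hl => exists_mem_paths hu hv (by omega) hl) hA

/-! ### The paths are disjoint oriented paths -/

/-- Strictly positive vertices in the lower layer are avoided by all paths. -/
theorem not_walk_of_mem {n k : ℕ} {P : OPath} (hP : P ∈ paths n k)
    (hlen : ∀ n k P, P ∈ paths n k → ∀ w ∈ P, w.length = 2 * n) {t : List Bool} {c : ℕ}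
    (hw : true :: t ∈ P) (hk : (true :: t).count true = k) : ¬ Walk 0 t c := by
  intro ht
  induction n generalizing k P t c with
  | zero => simp [paths] at hP
  | succ n ih =>
    have hl := hlen _ _ _ hP _ hw
    have hc := ht.count
    have hb := paths_bounds hP
    simp at hl hk
    cases n with
    | zero => omega
    | succ n =>
      -- For k = n + 2 the string 1∘t has height 0, so t would end at height -1. Otherwise the two
      -- attached bits are stripped; the remaining prefix is again in the lower layer.
      rcases mem_paths_add_two.1 hP with ⟨rfl, -⟩ | ⟨j, y, hy, P', hP', rfl⟩
      · omega
      · obtain ⟨w, hwP, hwt⟩ := mem_attach.1 hw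
        cases w with
        | nil => simpa using hlen _ _ _ hP' _ hwP
        | cons a w =>
          obtain ⟨rfl, rfl⟩ := List.cons_eq_cons.1 hwt
          obtain ⟨d, hd, -⟩ := walk_append.1 ht
          refine ih hP' hwP ?_ hd
          have := hy.count
          simp at hk ⊢
          omega

theorem length_of_mem {n k : ℕ} {P : OPath} (hP : P ∈ paths n k) {w : List Bool} (hw : w ∈ P) :
    w.length = 2 * n := by
  induction n generalizing k P w with
  | zero => simp [paths] at hP
  | succ n ih =>
    cases n with
    | zero =>
      obtain ⟨rfl, rfl⟩ := hP
      simp at hw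
      rcases hw with rfl | rfl | rfl <;> rfl
    | succ n =>
      rcases mem_paths_add_two.1 hP with ⟨rfl, E, hE, A, hA, hg⟩ | ⟨j, y, hy, P', hP', rfl⟩
      · rcases hg.mem_iff.1 hw with ⟨s, hs, rfl⟩ | ⟨e, he, rfl⟩ | ⟨b, hb, rfl⟩ | ⟨b, hb, rfl⟩
        · have := ih hE (List.mem_of_mem_tail (List.mem_of_mem_head? hs))
          simp; omega
        · have := ih hE (List.mem_of_mem_tail he)
          simp; omega
        · have := ih hA hb
          simp; omega
        · have := ih hA (List.mem_of_mem_head? hb)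
          simp; omega
      · obtain ⟨v, hv, rfl⟩ := mem_attach.1 hw
        have := ih hP' hv
        have := hy.1
        simp; omega

theorem count_head {n k : ℕ} {P : OPath} (hP : P ∈ paths n k) {a : List Bool}
    (ha : P.head? = some a) : a.count true = k := by
  obtain ⟨u, v, b, hs, hu, hv, hb, hl⟩ := exists_hasShape hP
  have h1 := hu.count
  have h2 := hv.count
  rw [hs.head, Option.some_inj] at ha
  subst ha
  simp
  omega

theorem count_second {n k : ℕ} {P : OPath} (hP : P ∈ paths n k) {a : List Bool}
    (ha : P.tail.head? = some a) : a.count true = k + 1 := by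
  obtain ⟨u, v, b, hs, hu, hv, hb, hl⟩ := exists_hasShape hP
  have h1 := hu.count
  have h2 := hv.count
  rw [hs.second, Option.some_inj] at ha
  subst ha
  simp
  omega

/-- The string f(a) is itself a Dyck path, hence the first vertex of some path G. Either G is `E`,
and its first vertex is not repeated, or G is disjoint from `E`. Simplicity and disjointness are
hypotheses so that the lemma can serve inside the induction proving them. -/
theorem f_head_not_mem_tail {n : ℕ} (ho : ∀ P ∈ paths n n, P.Nodup)
    (hd : ∀ P ∈ paths n n, ∀ P' ∈ paths n n, P ≠ P' → P.Disjoint P')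
    {E A : OPath} (hE : E ∈ paths n n) (hA : A ∈ paths n n) {a : List Bool}
    (ha : A.head? = some a) : f a ∉ E.tail := by
  obtain ⟨u, v, b, hs, hu, hv, hb, hl⟩ := exists_hasShape hA
  obtain rfl : b = 0 := by omega
  rw [hs.head, Option.some_inj] at ha
  subst ha
  obtain ⟨p, q, hpq, hp, hq⟩ := (walk_wrap hu hv).f.exists_decomp (by
    intro h
    have := congrArg List.length h
    simp at this)
  obtain ⟨G, hG, hh⟩ := exists_mem_paths (n := n) (k := n) hp hq (by omega) (by
    have := congrArg List.length hpq
    simp at this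
    omega)
  rw [hpq]
  intro hmem
  obtain ⟨G', rfl⟩ : ∃ G', G = (true :: p ++ false :: q) :: G' := by
    cases G with
    | nil => simp at hh
    | cons x G => exact ⟨G, by simpa using hh⟩
  by_cases hEG : (true :: p ++ false :: q) :: G' = E
  · subst hEG
    exact (List.nodup_cons.1 (ho _ hG)).1 hmem
  · exact hd _ hG _ hE hEG (by simp) (List.mem_of_mem_tail hmem)

theorem getLast?_disjoint {A A' : OPath} (h : A.Disjoint A') {a : List Bool}
    (ha : A.getLast? = some a) : A'.getLast? ≠ some a := fun h' =>
  h (List.mem_of_getLast? ha) (List.mem_of_getLast? h')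

/-- Both claims need a joint induction: a glued path is simple only because the paths one level
below are simple and disjoint. -/
theorem paths_isOrientedPath_and_disjoint (n : ℕ) :
    (∀ k, ∀ P ∈ paths n k, IsOrientedPath (2 * n) k P) ∧
      ∀ k, ∀ P ∈ paths n k, ∀ P' ∈ paths n k, P ≠ P' → P.Disjoint P' := by
  induction n with
  | zero => simp [paths]
  | succ n ih =>
    cases n with
    | zero =>
      constructor
      · rintro k P ⟨rfl, rfl⟩
        refine ⟨by simp, ?_, ?_, by decide⟩
        · simp [B]
        · simp [DifferInOneBit]
      · rintro k P ⟨rfl, rfl⟩ P' ⟨-, rfl⟩ h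
        exact absurd rfl h
    | succ n =>
      obtain ⟨ho, hd⟩ := ih
      have hf {E A : OPath} (hE : E ∈ paths (n + 1) (n + 1)) (hA : A ∈ paths (n + 1) (n + 1))
          {a : List Bool} (ha : A.head? = some a) : f a ∉ E.tail :=
        f_head_not_mem_tail (fun P hP => (ho _ P hP).nodup) (hd _) hE hA ha
      -- No vertex of a glued path ends in 10, and the only one ending in 00 is its first. Without
      -- the 00 this is 1∘u∘1∘v of lower-layer weight, where u∘1∘v stays nonnegative, and
      -- `not_walk_of_mem` keeps it off every path.
      have hge {E A Q j y P} (hE : E ∈ paths (n + 1) (n + 1)) (hg : IsGlued E A Q)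
          (hy : IsExtension n j (n + 2) y) (hP : P ∈ paths (n + 1) j) :
          Q.Disjoint (attach y P) := by
        intro w hw hw'
        obtain ⟨v, hv, rfl⟩ := mem_attach.1 hw'
        rcases hy.cases with rfl | rfl | rfl | rfl
        · rcases hg.mem_iff.1 hw with (⟨s, hs, e⟩ | ⟨s, hs, e⟩ | ⟨s, hs, e⟩ | ⟨s, hs, e⟩)
          · obtain rfl := List.append_cancel_right e
            obtain ⟨u, v', b, hs', hu, hv', hb, hl⟩ := exists_hasShape hE
            obtain rfl : b = 0 := by omega
            have hc := count_second hE hs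
            rw [hs'.second, Option.some_inj] at hs
            subst hs
            obtain ⟨rfl, -⟩ := isExtension_ff.1 hy
            exact not_walk_of_mem hP (fun n k P hP w hw => length_of_mem hP hw) hv hc
              (hu.append (by simpa using hv'.add_right 1))
          all_goals simpa using (List.append_inj' e rfl).2
        · rcases hg.mem_iff.1 hw with (⟨s, hs, e⟩ | ⟨s, hs, e⟩ | ⟨s, hs, e⟩ | ⟨s, hs, e⟩)
          all_goals simpa using (List.append_inj' e rfl).2
        · have := isExtension_ft.1 hy
          omega
        · have := isExtension_tt.1 hy
          omega
      constructor
      · intro k Q hQ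
        rcases mem_paths_add_two.1 hQ with ⟨rfl, E, hE, A, hA, hg⟩ | ⟨j, y, hy, P, hP, rfl⟩
        · exact hg.isOrientedPath (ho _ _ hE) (ho _ _ hA) (fun s hs => count_second hE hs)
            fun a ha => ⟨count_head hA ha, hf hE hA ha⟩
        · have := (ho _ _ hP).attach y
          rwa [hy.1, hy.count] at this
      · intro k Q hQ Q' hQ' hne
        rcases mem_paths_add_two.1 hQ with ⟨rfl, E, hE, A, hA, hg⟩ | ⟨j, y, hy, P, hP, rfl⟩ <;>
        rcases mem_paths_add_two.1 hQ' with
          ⟨hk, E', hE', A', hA', hg'⟩ | ⟨j', y', hy', P', hP', rfl⟩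
        · have hEA := hg.getLast?_eq
          have hEA' := hg'.getLast?_eq
          -- The last vertices of `E` and `A` determine each other through the injective map f, and
          -- disjoint paths have different last vertices.
          have hiff : E = E' ↔ A = A' := by
            constructor
            · rintro rfl
              by_contra hAA
              obtain ⟨u, v, b, hs, -⟩ := exists_hasShape hA
              obtain ⟨u', v', b', hs', -⟩ := exists_hasShape hA'
              rw [hEA, hs.last, hs'.last, Option.map_some, Option.map_some, Option.some_inj] at hEA'
              exact getLast?_disjoint (hd _ _ hA _ hA' hAA) hs.last
                (f_injective hEA' ▸ hs'.last)
            · rintro rfl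
              by_contra hEE
              obtain ⟨u, v, b, hs, -⟩ := exists_hasShape hE
              exact getLast?_disjoint (hd _ _ hE _ hE' hEE) hs.last
                (by rw [hEA', ← hEA, hs.last])
          by_cases hEE : E = E'
          · obtain rfl := hiff.1 hEE
            subst hEE
            refine absurd ?_ hne
            obtain ⟨u, v, l, a, l', h⟩ := hg
            cases hg'
            rfl
          · have hAA : A ≠ A' := fun h => hEE (hiff.2 h)
            exact hg.disjoint hg' (hd _ _ hE _ hE' hEE) (hd _ _ hA _ hA' hAA)
              (fun a ha => hf hE' hA ha) (fun a ha => hf hE hA' ha)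
        · exact hge hE hg hy' hP'
        · subst hk
          exact (hge hE' hg' hy hP).symm
        · by_cases hyy : y = y'
          · subst hyy
            obtain rfl : j = j' := by
              have := hy.count
              have := hy'.count
              omega
            exact attach_disjoint (hd _ _ hP _ hP' (by rintro rfl; exact hne rfl))
          · exact attach_disjoint_of_ne (by rw [hy.1, hy'.1]) hyy P P'

theorem isOrientedPath_of_mem {n k : ℕ} {P : OPath} (hP : P ∈ paths n k) :
    IsOrientedPath (2 * n) k P := (paths_isOrientedPath_and_disjoint n).1 k P hP

theorem disjoint_of_mem {n k : ℕ} {P P' : OPath} (hP : P ∈ paths n k) (hP' : P' ∈ paths n k)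
    (hne : P ≠ P') : P.Disjoint P' :=
  (paths_isOrientedPath_and_disjoint n).2 k P hP P' hP' hne

/-! ### The recursion for the flippable pairs -/

theorem FlipSystem.bounds {n k : ℕ} {P P' R R' : OPath} (h : FlipSystem n k P P' R R') :
    2 ≤ n ∧ n ≤ k ∧ k + 1 ≤ 2 * n := by
  match n with
  | 0 => exact h.elim
  | 1 => exact h.elim
  | 2 =>
    obtain ⟨rfl, -⟩ := h
    omega
  | n + 3 =>
    rcases h with ⟨rfl, -⟩ | ⟨h1, h2, -⟩ <;> omega

theorem flipSystem_two {k : ℕ} {P P' R R' : OPath} : FlipSystem 2 k P P' R R' ↔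
    k = 2 ∧ ((P = P₄ ∧ P' = P₄' ∧ R = R₄ ∧ R' = R₄') ∨
      (P = P₄' ∧ P' = P₄ ∧ R = R₄' ∧ R' = R₄)) := Iff.rfl

theorem flipSystem_add_three {n k : ℕ} {P P' R R' : OPath} :
    FlipSystem (n + 3) k P P' R R' ↔
      (k = n + 3 ∧ ∃ A A' C C', FlipSystem (n + 2) (n + 2) A A' C C' ∧
        ∃ E ∈ paths (n + 2) (n + 2), ∃ E' ∈ paths (n + 2) (n + 2),
          IsGlued E A P ∧ IsGlued E' A' P' ∧ IsGlued E C' R ∧ IsGlued E' C R') ∨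
      ∃ j y, IsExtension (n + 1) j k y ∧ ∃ A A' C C', FlipSystem (n + 2) j A A' C C' ∧
        P = attach y A ∧ P' = attach y A' ∧ R = attach y C ∧ R' = attach y C' := by
  rw [FlipSystem]
  constructor
  · rintro (⟨rfl, h | h | h⟩ | ⟨h1, h2, h | h | h | h⟩)
    · exact .inr ⟨_, _, isExtension_ff.2 ⟨rfl, le_rfl⟩, h⟩
    · exact .inr ⟨_, _, isExtension_tf.2 ⟨rfl, le_rfl⟩, h⟩
    · exact .inl ⟨rfl, h⟩
    · exact .inr ⟨_, _, isExtension_ff.2 ⟨rfl, by omega⟩, h⟩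
    · exact .inr ⟨_, _, isExtension_tf.2 ⟨by omega, by omega⟩, h⟩
    · exact .inr ⟨_, _, isExtension_ft.2 ⟨by omega, by omega⟩, h⟩
    · exact .inr ⟨_, _, isExtension_tt.2 ⟨by omega, by omega⟩, h⟩
  · rintro (⟨rfl, h⟩ | ⟨j, y, hy, h⟩)
    · exact .inl ⟨rfl, .inr (.inr h)⟩
    · have hb : n + 2 ≤ j ∧ j + 1 ≤ 2 * (n + 2) := by
        obtain ⟨A, A', C, C', h, -⟩ := h
        exact h.bounds.2
      rcases hy.cases with rfl | rfl | rfl | rfl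
      · obtain ⟨rfl, h1⟩ := isExtension_ff.1 hy
        rcases h1.eq_or_lt with rfl | h1
        · exact .inl ⟨rfl, .inl h⟩
        · exact .inr ⟨h1, by omega, .inl h⟩
      · obtain ⟨rfl, h1⟩ := isExtension_tf.1 hy
        rcases h1.eq_or_lt with h1 | h1
        · obtain rfl : j = n + 2 := by omega
          exact .inl ⟨rfl, .inr (.inl h)⟩
        · exact .inr ⟨h1, by omega, .inr (.inl h)⟩
      · obtain ⟨rfl, h1⟩ := isExtension_ft.1 hy
        exact .inr ⟨h1, by omega, .inr (.inr (.inl h))⟩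
      · obtain ⟨rfl, h1⟩ := isExtension_tt.1 hy
        exact .inr ⟨h1, by omega, .inr (.inr (.inr h))⟩

theorem FlipSystem.symm {n k : ℕ} {P P' R R' : OPath} (h : FlipSystem n k P P' R R') :
    FlipSystem n k P' P R' R := by
  induction n using Nat.strong_induction_on generalizing k P P' R R' with
  | _ n ih =>
    match n with
    | 0 => exact h.elim
    | 1 => exact h.elim
    | 2 =>
      rw [flipSystem_two] at h ⊢
      tauto
    | n + 3 =>
      rw [flipSystem_add_three] at h ⊢
      rcases h with ⟨rfl, A, A', C, C', h, E, hE, E', hE', h1, h2, h3, h4⟩ |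
        ⟨j, y, hy, A, A', C, C', h, h1, h2, h3, h4⟩
      · exact .inl ⟨rfl, A', A, C', C, ih _ (by omega) h, E', hE', E, hE, h2, h1, h4, h3⟩
      · exact .inr ⟨j, y, hy, A', A, C', C, ih _ (by omega) h, h2, h1, h4, h3⟩

theorem P₄_mem : P₄ ∈ paths 2 2 :=
  mem_paths_add_two.2 (.inl ⟨rfl, _, ⟨rfl, rfl⟩, _, ⟨rfl, rfl⟩,
    .mk [true, false] [true, true] [[false, true]] [true, false] [[true, true], [false, true]] rfl⟩)

theorem P₄'_mem : P₄' ∈ paths 2 2 :=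
  mem_paths_add_two.2 (.inr ⟨1, [true, false], isExtension_tf.2 ⟨rfl, le_rfl⟩, _, ⟨rfl, rfl⟩, rfl⟩)

theorem FlipSystem.left_mem {n k : ℕ} {P P' R R' : OPath} (h : FlipSystem n k P P' R R') :
    P ∈ paths n k := by
  induction n using Nat.strong_induction_on generalizing k P P' R R' with
  | _ n ih =>
    match n with
    | 0 => exact h.elim
    | 1 => exact h.elim
    | 2 =>
      obtain ⟨rfl, ⟨rfl, -⟩ | ⟨rfl, -⟩⟩ := h
      · exact P₄_mem
      · exact P₄'_mem
    | n + 3 =>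
      rcases flipSystem_add_three.1 h with ⟨rfl, A, A', C, C', hA, E, hE, E', hE', h1, -⟩ |
        ⟨j, y, hy, A, A', C, C', hA, rfl, -⟩
      · exact mem_paths_add_two.2 (.inl ⟨rfl, E, hE, A, ih _ (by omega) hA, h1⟩)
      · exact mem_paths_add_two.2 (.inr ⟨j, y, hy, A, ih _ (by omega) hA, rfl⟩)

theorem FlipSystem.right_mem {n k : ℕ} {P P' R R' : OPath} (h : FlipSystem n k P P' R R') :
    P' ∈ paths n k := h.symm.left_mem

theorem IsFlippedPair.attach {m k : ℕ} {P P' R R' : OPath} (h : IsFlippedPair m k P P' R R')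
    (y : List Bool) : IsFlippedPair (m + y.length) (k + y.count true)
      (attach y P) (attach y P') (attach y R) (attach y R') where
  isPath := h.isPath.attach y
  isPath' := h.isPath'.attach y
  isPath_flipped := h.isPath_flipped.attach y
  isPath_flipped' := h.isPath_flipped'.attach y
  disjoint := attach_disjoint h.disjoint
  disjoint_flipped := attach_disjoint h.disjoint_flipped
  vertices := by
    have hv := fun v => Set.ext_iff.1 h.vertices v
    simp only [Set.mem_union, Set.mem_ofPred_eq] at hv
    ext w
    simp only [Set.mem_union, Set.mem_ofPred_eq, mem_attach, ← exists_or, ← or_and_right, hv]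
  first := by rw [head?_attach, head?_attach, h.first]
  first' := by rw [head?_attach, head?_attach, h.first']
  last := by rw [getLast?_attach, getLast?_attach, h.last]
  last' := by rw [getLast?_attach, getLast?_attach, h.last']

/-- Replacing `A` by `C'` keeps the last vertex, so glueing to `E` remains possible, while the first
vertex becomes that of `A'`. Thus the starts, which depend only on `E` and `E'`, stay, and the ends
f(F(A))∘01 and f(F(A'))∘01 are exchanged. -/
theorem IsFlippedPair.glued {m : ℕ} {A A' C C' E E' P P' R R' : OPath}
    (h : IsFlippedPair (2 * m) m A A' C C')
    (hE : E ∈ paths m m) (hE' : E' ∈ paths m m) (hA : A ∈ paths m m) (hA' : A' ∈ paths m m)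
    (hP : IsGlued E A P) (hP' : IsGlued E' A' P') (hR : IsGlued E C' R) (hR' : IsGlued E' C R') :
    IsFlippedPair (2 * (m + 1)) (m + 1) P P' R R' := by
  have hf {E A : OPath} (hE : E ∈ paths m m) (hA : A ∈ paths m m)
      {a : List Bool} (ha : A.head? = some a) : f a ∉ E.tail :=
    f_head_not_mem_tail (fun P hP => (isOrientedPath_of_mem hP).nodup)
      (fun _ hP _ hP' hne => disjoint_of_mem hP hP' hne) hE hA ha
  have hEE : E.Disjoint E' := by
    refine disjoint_of_mem hE hE' ?_
    rintro rfl
    obtain ⟨u, v, b, hs, -⟩ := exists_hasShape hA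
    obtain ⟨u', v', b', hs', -⟩ := exists_hasShape hA'
    have h1 := hP.getLast?_eq
    rw [hP'.getLast?_eq, hs.last, hs'.last, Option.map_some, Option.map_some,
      Option.some_inj] at h1
    exact getLast?_disjoint h.disjoint hs.last (f_injective h1 ▸ hs'.last)
  have hEo := isOrientedPath_of_mem hE
  have hEo' := isOrientedPath_of_mem hE'
  have hhead : ∀ s, E.tail.head? = some s → s.count true = m + 1 := fun s => count_second hE
  have hhead' : ∀ s, E'.tail.head? = some s → s.count true = m + 1 := fun s => count_second hE'
  constructor
  · exact hP.isOrientedPath hEo h.isPath hhead fun a ha => ⟨count_head hA ha, hf hE hA ha⟩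
  · exact hP'.isOrientedPath hEo' h.isPath' hhead' fun a ha => ⟨count_head hA' ha, hf hE' hA' ha⟩
  · exact hR.isOrientedPath hEo h.isPath_flipped' hhead fun a ha => by
      rw [← h.first'] at ha
      exact ⟨count_head hA' ha, hf hE hA' ha⟩
  · exact hR'.isOrientedPath hEo' h.isPath_flipped hhead' fun a ha => by
      rw [← h.first] at ha
      exact ⟨count_head hA ha, hf hE' hA ha⟩
  · exact hP.disjoint hP' hEE h.disjoint (fun a ha => hf hE' hA ha) (fun a ha => hf hE hA' ha)
  · refine hR.disjoint hR' hEE h.disjoint_flipped.symm (fun a ha => ?_) (fun a ha => ?_)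
    · rw [← h.first'] at ha
      exact hf hE' hA' ha
    · rw [← h.first] at ha
      exact hf hE hA ha
  · have hv := fun v => Set.ext_iff.1 h.vertices v
    simp only [Set.mem_union, Set.mem_ofPred_eq] at hv
    have key : ∀ w : List Bool, ((∃ a ∈ A, w = f a ++ [true, true]) ∨
        ∃ a ∈ A', w = f a ++ [true, true]) ↔ ((∃ a ∈ C, w = f a ++ [true, true]) ∨
        ∃ a ∈ C', w = f a ++ [true, true]) := by
      intro w
      simp only [← exists_or, ← or_and_right, hv]
    ext w
    have := key w
    simp only [Set.mem_union, Set.mem_ofPred_eq, hP.mem_iff, hP'.mem_iff, hR.mem_iff, hR'.mem_iff,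
      h.first, h.first']
    -- The 00 and 01 vertices coming from `E` and `E'` stay in place; the two final vertices `p`,
    -- `p'` change sides, and the 11 parts agree only as a union.
    have aux {s t a s' t' a' c c' p p' : Prop} (h : a ∨ a' ↔ c ∨ c') :
        (s ∨ t ∨ a ∨ p) ∨ (s' ∨ t' ∨ a' ∨ p') ↔ (s ∨ t ∨ c' ∨ p') ∨ (s' ∨ t' ∨ c ∨ p) := by
      grind
    exact aux this
  · rw [hP.head?, hR.head?]
  · rw [hP'.head?, hR'.head?]
  · rw [hP.getLast?, hR'.getLast?, h.first]
  · rw [hP'.getLast?, hR.getLast?, h.first']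

theorem isFlippedPair_four : IsFlippedPair 4 2 P₄ P₄' R₄ R₄' := by
  have h1 := isOrientedPath_of_mem P₄_mem
  have h2 := isOrientedPath_of_mem P₄'_mem
  refine ⟨h1, h2, ⟨by simp [R₄], ?_, ?_, by decide⟩, ⟨by simp [R₄'], ?_, ?_, by decide⟩,
    by simp [P₄, P₄'], by simp [R₄, R₄'], ?_, rfl, rfl, rfl, rfl⟩
  · simp [R₄, B]
  · simp [R₄, DifferInOneBit]
  · simp [R₄', B]
  · simp [R₄', DifferInOneBit]
  · ext w
    simp only [P₄, P₄', R₄, R₄', Set.mem_union, Set.mem_ofPred_eq, List.mem_cons,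
      List.not_mem_nil, or_false]
    tauto

theorem isFlippedPair_four' : IsFlippedPair 4 2 P₄' P₄ R₄' R₄ := by
  have h := isFlippedPair_four
  exact ⟨h.isPath', h.isPath, h.isPath_flipped', h.isPath_flipped, h.disjoint.symm,
    h.disjoint_flipped.symm, by rw [Set.union_comm, h.vertices, Set.union_comm],
    h.first', h.first, h.last', h.last⟩

theorem FlipSystem.isFlippedPair {n k : ℕ} {P P' R R' : OPath} (h : FlipSystem n k P P' R R') :
    IsFlippedPair (2 * n) k P P' R R' := by
  induction n using Nat.strong_induction_on generalizing k P P' R R' with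
  | _ n ih =>
    match n with
    | 0 => exact h.elim
    | 1 => exact h.elim
    | 2 =>
      obtain ⟨rfl, ⟨rfl, rfl, rfl, rfl⟩ | ⟨rfl, rfl, rfl, rfl⟩⟩ := h
      · exact isFlippedPair_four
      · exact isFlippedPair_four'
    | n + 3 =>
      rcases flipSystem_add_three.1 h with ⟨rfl, A, A', C, C', hA, E, hE, E', hE', h1, h2, h3, h4⟩ |
        ⟨j, y, hy, A, A', C, C', hA, rfl, rfl, rfl, rfl⟩
      · exact (ih _ (by omega) hA).glued hE hE' hA.left_mem hA.right_mem h1 h2 h3 h4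
      · have := (ih _ (by omega) hA).attach y
        rwa [hy.1, hy.count] at this

/-! ### The first vertices of flippable pairs -/

/-- There is a flippable pair for `𝒫_{2n}(k, k+1)` with first vertices `x` and `x'`. -/
def IsFlippableHeads (n k : ℕ) (x x' : List Bool) : Prop :=
  ∃ P P' R R', FlipSystem n k P P' R R' ∧ P.head? = some x ∧ P'.head? = some x'

theorem IsFlippableHeads.symm {n k : ℕ} {x x' : List Bool} (h : IsFlippableHeads n k x x') :
    IsFlippableHeads n k x' x := by
  obtain ⟨P, P', R, R', h, h1, h2⟩ := h
  exact ⟨P', P, R', R, h.symm, h2, h1⟩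

theorem isFlippableHeads_four :
    IsFlippableHeads 2 2 [true, true, false, false] [true, false, true, false] :=
  ⟨_, _, _, _, flipSystem_two.2 ⟨rfl, .inl ⟨rfl, rfl, rfl, rfl⟩⟩, rfl, rfl⟩

/-- Two bits are split off the end of `y` at a time; every prefix of even length is a walk to an
even height and so belongs to some k. -/
theorem IsFlippableHeads.append {m j n k b c : ℕ} {x x' y : List Bool}
    (h : IsFlippableHeads m j x x') (hy : Walk b y c) (hl : 2 * m + y.length = 2 * n)
    (hb : b + 2 * m = 2 * j) (hc : c + 2 * n = 2 * k) :
    IsFlippableHeads n k (x ++ y) (x' ++ y) := by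
  obtain ⟨l, hl⟩ : ∃ l, n = m + l := ⟨n - m, by omega⟩
  subst hl
  induction l generalizing k c y with
  | zero =>
    obtain rfl : y = [] := List.eq_nil_of_length_eq_zero (by omega)
    simp at hy
    obtain rfl : j = k := by omega
    simpa using h
  | succ l ih =>
    obtain ⟨v, z, rfl, hz⟩ : ∃ v z, y = v ++ z ∧ z.length = 2 :=
      ⟨y.take (y.length - 2), y.drop (y.length - 2), by simp, by simp; omega⟩
    obtain ⟨d, hv, hz'⟩ := walk_append.1 hy
    have h1 := hv.count
    have h2 := hz'.count
    simp at hl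
    obtain ⟨P, P', R, R', hF, hP, hP'⟩ := ih (k := k - z.count true) hv (by omega) (by omega)
    have hm : 2 ≤ m := by
      obtain ⟨_, _, _, _, h, -⟩ := h
      exact h.bounds.1
    obtain ⟨n, rfl⟩ : ∃ n, m = n + 2 := ⟨m - 2, by omega⟩
    rw [show n + 2 + (l + 1) = n + l + 3 by ring] at hc ⊢
    rw [show n + 2 + l = n + l + 2 by ring] at hF
    refine ⟨_, _, _, _, flipSystem_add_three.2 (.inr ⟨_, z, ⟨hz, d, c, hz', ?_, by omega⟩,
      P, P', R, R', hF, rfl, rfl, rfl, rfl⟩), ?_, ?_⟩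
    · omega
    · simp [head?_attach, hP]
    · simp [head?_attach, hP']

/-- Glueing turns the first vertex `x` of `A` into `1 ∘ revBar(x) ∘ 0`. -/
theorem IsGlued.head?_eq {m : ℕ} {E A Q : OPath} (hg : IsGlued E A Q) (hE : E ∈ paths m m)
    (hA : A ∈ paths m m) {x : List Bool} (hx : A.head? = some x) :
    Q.head? = some (true :: revBar x ++ [false]) := by
  obtain ⟨u, v, b, hs, hu, hv, hb, -⟩ := exists_hasShape hE
  obtain ⟨p, q, c, hs', hp, hq, hc, -⟩ := exists_hasShape hA
  obtain rfl : c = 0 := by omega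
  rw [hs'.head, Option.some_inj] at hx
  rw [(HasShape.isGlued hg hs hs' hu hp hq).2.2.head, hx]

theorem IsFlippableHeads.wrap {m : ℕ} {x x' : List Bool} (h : IsFlippableHeads m m x x') :
    IsFlippableHeads (m + 1) (m + 1) (true :: revBar x ++ [false])
      (true :: revBar x' ++ [false]) := by
  obtain ⟨A, A', C, C', h, hx, hx'⟩ := h
  have hf := h.isFlippedPair
  obtain ⟨n, rfl⟩ : ∃ n, m = n + 2 := ⟨m - 2, by have := h.bounds.1; omega⟩
  obtain ⟨E, hE, -, H⟩ := exists_partner h.left_mem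
  obtain ⟨E', hE', -, H'⟩ := exists_partner h.right_mem
  obtain ⟨P, hP⟩ := H A rfl
  obtain ⟨P', hP'⟩ := H' A' rfl
  obtain ⟨R, hR⟩ := H C' hf.last.symm
  obtain ⟨R', hR'⟩ := H' C hf.last'.symm
  exact ⟨P, P', R, R', flipSystem_add_three.2 (.inl ⟨rfl, A, A', C, C', h, E, hE, E', hE',
    hP, hP', hR, hR'⟩), hP.head?_eq hE h.left_mem hx, hP'.head?_eq hE' h.right_mem hx'⟩

/-- The pairs of first vertices of flippable pairs, as generated by the recursion. -/
inductive HeadPair : List Bool → List Bool → Prop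
  | base (y : List Bool) : HeadPair (true :: true :: false :: false :: y)
      (true :: false :: true :: false :: y)
  | base' (y : List Bool) : HeadPair (true :: false :: true :: false :: y)
      (true :: true :: false :: false :: y)
  | wrap (z z' y : List Bool) : HeadPair z z' → Walk 0 z 0 → Walk 0 z' 0 →
      HeadPair (true :: revBar z ++ false :: y) (true :: revBar z' ++ false :: y)

theorem HeadPair.append {x x' : List Bool} (h : HeadPair x x') (y : List Bool) :
    HeadPair (x ++ y) (x' ++ y) := by
  cases h with
  | base z => exact .base _
  | base' z => exact .base' _
  | wrap z z' v h hz hz' => simpa using HeadPair.wrap z z' (v ++ y) h hz hz'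

theorem walk_head {m : ℕ} {A : OPath} (hA : A ∈ paths m m) {x : List Bool}
    (hx : A.head? = some x) : Walk 0 x 0 ∧ x.length = 2 * m := by
  obtain ⟨p, q, c, hs', hp, hq, hc, hl⟩ := exists_hasShape hA
  obtain rfl : c = 0 := by omega
  rw [hs'.head, Option.some_inj] at hx
  subst hx
  refine ⟨walk_wrap hp hq, ?_⟩
  simp
  omega

theorem FlipSystem.headPair {n k : ℕ} {P P' R R' : OPath} (h : FlipSystem n k P P' R R')
    {x x' : List Bool} (hx : P.head? = some x) (hx' : P'.head? = some x') : HeadPair x x' := by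
  induction n using Nat.strong_induction_on generalizing k P P' R R' x x' with
  | _ n ih =>
    match n with
    | 0 => exact h.elim
    | 1 => exact h.elim
    | 2 =>
      obtain ⟨rfl, ⟨rfl, rfl, -⟩ | ⟨rfl, rfl, -⟩⟩ := h <;>
      · obtain rfl := Option.some_inj.1 hx
        obtain rfl := Option.some_inj.1 hx'
        constructor
    | n + 3 =>
      rcases flipSystem_add_three.1 h with ⟨rfl, A, A', C, C', hA, E, hE, E', hE', h1, h2, -⟩ |
        ⟨j, y, hy, A, A', C, C', hA, rfl, rfl, -⟩
      · obtain ⟨u, v, b, hs, -⟩ := exists_hasShape hA.left_mem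
        obtain ⟨u', v', b', hs', -⟩ := exists_hasShape hA.right_mem
        have e := h1.head?_eq hE hA.left_mem hs.head
        have e' := h2.head?_eq hE' hA.right_mem hs'.head
        rw [hx, Option.some_inj] at e
        rw [hx', Option.some_inj] at e'
        subst e e'
        exact .wrap _ _ [] (ih _ (by omega) hA hs.head hs'.head) (walk_head hA.left_mem hs.head).1
          (walk_head hA.right_mem hs'.head).1
      · obtain ⟨u, v, b, hs, -⟩ := exists_hasShape hA.left_mem
        obtain ⟨u', v', b', hs', -⟩ := exists_hasShape hA.right_mem
        have := (ih _ (by omega) hA hs.head hs'.head).append y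
        rw [head?_attach, hs.head, Option.map_some, Option.some_inj] at hx
        rw [head?_attach, hs'.head, Option.map_some, Option.some_inj] at hx'
        rwa [hx, hx'] at this

/-! ### Membership in `DZero` -/

theorem height_cons (b : Bool) (x : List Bool) :
    height (b :: x) = (if b then 1 else -1) + height x := by
  cases b <;> simp [height] <;> ring

theorem Walk.height {x : List Bool} {a b : ℕ} (h : Walk a x b) : (a : ℤ) + height x = b := by
  induction x generalizing a with
  | nil => simpa [MiddleLevels.height] using h
  | cons d x ih =>
    cases d
    · cases a with
      | zero => simp at h
      | succ a =>
        have := ih (by simpa using h)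
        rw [height_cons]
        push_cast
        simp
        omega
    · have := ih (by simpa using h : Walk (a + 1) x b)
      rw [height_cons]
      push_cast at this
      simp
      omega

theorem exists_walk {x : List Bool} {a : ℕ}
    (h : ∀ i ≤ x.length, 0 ≤ (a : ℤ) + height (x.take i)) : ∃ b, Walk a x b := by
  induction x generalizing a with
  | nil => exact ⟨a, by simp⟩
  | cons d x ih =>
    have hs : ∀ i ≤ x.length, 0 ≤ (a : ℤ) + ((if d then 1 else -1) + height (x.take i)) := by
      intro i hi
      rw [← height_cons]
      exact h (i + 1) (by simpa using hi)
    cases d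
    · cases a with
      | zero =>
        have := hs 0 (by omega)
        simp [height] at this
      | succ a =>
        obtain ⟨b, hb⟩ := ih (a := a) (fun i hi => by
          have := hs i hi
          push_cast at this
          simp at this
          omega)
        exact ⟨b, by simpa using hb⟩
    · obtain ⟨b, hb⟩ := ih (a := a + 1) (fun i hi => by
        have := hs i hi
        push_cast
        simp at this
        omega)
      exact ⟨b, by simpa using hb⟩

/-- With n upsteps among 2n steps the path ends at height 0, so the required contact with the axis
is automatic. -/
theorem mem_DZero_iff {n : ℕ} {x : List Bool} :
    x ∈ DZero (2 * n) n ↔ x.length = 2 * n ∧ Walk 0 x 0 := by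
  constructor
  · rintro ⟨⟨⟨hl, hc⟩, hh⟩, -⟩
    obtain ⟨b, hb⟩ := exists_walk (x := x) (a := 0) (fun i hi => by
      simpa using hh i (by omega))
    have := hb.count
    obtain rfl : b = 0 := by omega
    exact ⟨hl, hb⟩
  · rintro ⟨hl, hw⟩
    have hc := hw.count
    refine ⟨⟨⟨hl, by omega⟩, fun i _ => ?_⟩, ?_⟩
    · rw [← List.take_append_drop i x] at hw
      obtain ⟨c, hc, -⟩ := walk_append.1 hw
      have := hc.height
      push_cast at this
      omega
    · rcases n.eq_zero_or_pos with rfl | hn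
      · exact .inl rfl
      · refine .inr ⟨2 * n, by omega, le_rfl, ?_⟩
        rw [← hl, List.take_length]
        simpa using hw.height

namespace OrdTree

/-! ### The bijection `h` -/

theorem walk_h (T : OrdTree) : Walk 0 (h T) 0 := by
  induction T with
  | root => simp [h]
  | graft s t hs ht => exact walk_wrap hs.permPi ht

theorem length_h (T : OrdTree) : (h T).length = 2 * T.edges := by
  induction T with
  | root => rfl
  | graft s t hs ht =>
    simp [h, edges, hs, ht]
    ring

theorem h_injective : Function.Injective h := by
  intro S
  induction S with
  | root =>
    intro T e
    cases T with
    | root => rfl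
    | graft s t => simp [h] at e
  | graft a b ha hb =>
    intro T e
    cases T with
    | root => simp [h] at e
    | graft s t =>
      obtain ⟨h1, h2⟩ := (walk_h a).permPi.decomp_unique (walk_h s).permPi
        (List.cons_injective e)
      rw [ha (by simpa using congrArg permPi h1), hb h2]

theorem exists_h_eq {x : List Bool} (hx : Walk 0 x 0) : ∃ T, h T = x := by
  induction hn : x.length using Nat.strong_induction_on generalizing x with
  | _ n ih =>
    by_cases hne : x = []
    · exact ⟨root, by rw [hne, h]⟩
    · obtain ⟨u, v, rfl, hu, hv⟩ := hx.exists_decomp hne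
      simp at hn
      obtain ⟨s, hs⟩ := ih u.length (by omega) (x := permPi u) hu.permPi (by simp)
      obtain ⟨t, ht⟩ := ih v.length (by omega) hv rfl
      exact ⟨graft s t, by simp [h, hs, ht]⟩

theorem hInv_h {n : ℕ} {T : OrdTree} (hT : T.edges = n) : hInv n (h T) = T :=
  h_injective (Function.invFunOn_eq (s := {S : OrdTree | S.edges = n}) ⟨T, hT, rfl⟩)

/-! ### Right ends of trees -/

theorem h_addLast (t s : OrdTree) :
    h (t.addLast s) = h t ++ true :: permPi (h s) ++ [false] := by
  induction t with
  | root => simp [addLast, h]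
  | graft a t _ ih => simp [addLast, h, ih]

theorem edges_addLast (t s : OrdTree) : (t.addLast s).edges = t.edges + s.edges + 1 := by
  induction t with
  | root => simp [addLast, edges]
  | graft a t _ ih => simp [addLast, edges, ih]; ring

theorem exists_addLast_eq (t s : OrdTree) : ∃ b c, t.addLast s = graft b c := by
  cases t <;> exact ⟨_, _, rfl⟩

theorem dropLast_addLast (t s : OrdTree) : (t.addLast s).dropLast = t := by
  induction t with
  | root => rfl
  | graft a t _ ih =>
    obtain ⟨b, c, h⟩ := exists_addLast_eq t s
    rw [addLast, h, dropLast, ← h, ih]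

theorem growLast_addLast (t s : OrdTree) : (t.addLast s).growLast = t.addLast s.growLast := by
  induction t with
  | root => simp [addLast, growLast]
  | graft a t _ ih =>
    obtain ⟨b, c, h⟩ := exists_addLast_eq t s
    rw [addLast, h, growLast, ← h, ih, addLast]

theorem revBar_h_addLast (t s : OrdTree) :
    revBar (h (t.addLast s)) = true :: f (h s) ++ false :: revBar (h t) := by
  simp [h_addLast, f]

theorem f_h_eq (s : OrdTree) : f (h s) = permPi (revBar (h s)) :=
  revBar_permPi (walk_h s).even_length

theorem f_h_addLast (t s : OrdTree) : f (h (t.addLast s)) =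
    true :: swapPairs (f (h s)) ++ swapPairs (false :: revBar (h t)) := by
  rw [f_h_eq, revBar_h_addLast, permPi_wrap _ (walk_h s).f.even_length]

/-- By `f_h_addLast`, descending to the rightmost child swaps the pairs of the code and puts a 1 in
front. This takes 10∘u to 1∘01∘…, which again starts with 10, and takes 1010∘u to 1∘0101∘…, which
starts with 1010; the remainders agree. -/
theorem LastLeafThin.exists_f_h {w : OrdTree} (hw : LastLeafThin w) :
    ∃ u, f (h w) = true :: false :: u ∧
      f (h w.growLast) = true :: false :: true :: false :: u := by
  induction hw with
  | single => exact ⟨[], rfl, rfl⟩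
  | step a w _ ih =>
    obtain ⟨u, h1, h2⟩ := ih
    rw [growLast_addLast, f_h_addLast, f_h_addLast, h1, h2]
    exact ⟨true :: swapPairs u ++ swapPairs (false :: revBar (h a)), by simp, by simp⟩

theorem LastLeafThin.edges_growLast {w : OrdTree} (hw : LastLeafThin w) :
    w.growLast.edges = w.edges + 1 := by
  induction hw with
  | single => rfl
  | step a w _ ih => rw [growLast_addLast, edges_addLast, edges_addLast, ih]; ring

/-! ### Codes of leftmost subtrees and the two tree transformations -/

/-- The bitstring `f(h(s))`, where `s` is the leftmost subtree of the root. -/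
def leftCode : OrdTree → List Bool
  | root => []
  | graft s _ => f (h s)

theorem f_h_injective : Function.Injective (fun s => f (h s)) := f_injective.comp h_injective

/-- This is what the second transformation means for codes: moving the leaf `u` replaces the prefix
1100 of f(h(s)) by 1010 and leaves the rest of the code and the tree `t` alone. -/
theorem exists_of_mem_treesTwo {n : ℕ} {T : OrdTree} (hT : T ∈ treesTwo n) :
    ∃ s s' t y, T = graft s t ∧ tauTwo T = graft s' t ∧ (tauTwo T).edges = n ∧
      f (h s) = true :: true :: false :: false :: y ∧
      f (h s') = true :: false :: true :: false :: y := by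
  obtain ⟨hn, a, w, t, hw, rfl⟩ := hT
  obtain ⟨u, h1, h2⟩ := hw.exists_f_h
  have hu : Even u.length := by
    have := (walk_h w).f.even_length
    rw [h1] at this
    simp at this
    grind
  have htau : tauTwo (graft ((a.addLast w).addLast root) t) =
      graft (a.addLast w.growLast) t := by
    rw [tauTwo, dropLast_addLast, growLast_addLast]
  refine ⟨_, _, t, true :: swapPairs u ++ swapPairs (false :: revBar (h a)), rfl, htau, ?_, ?_, ?_⟩
  · rw [htau, ← hn]
    simp only [edges, edges_addLast, hw.edges_growLast]
    ring
  · rw [f_h_addLast, revBar_h_addLast, h1]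
    simp [h, f, swapPairs_append _ hu]
  · rw [f_h_addLast, h2]
    simp

theorem leftCode_of_mem_treesOne {n : ℕ} {T : OrdTree} (hT : T ∈ treesOne n) :
    leftCode T = [true, false] := by
  obtain ⟨-, -, t, rfl⟩ := hT
  rfl

theorem leftCode_of_mem_image_tauOne {n : ℕ} {T : OrdTree} (hT : T ∈ tauOne '' treesOne n) :
    leftCode T = [] := by
  obtain ⟨_, ⟨-, -, t, rfl⟩, rfl⟩ := hT
  rfl

theorem leftCode_of_mem_treesTwo {n : ℕ} {T : OrdTree} (hT : T ∈ treesTwo n) :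
    ∃ y, leftCode T = true :: true :: false :: false :: y := by
  obtain ⟨s, s', t, y, rfl, -, -, h1, -⟩ := exists_of_mem_treesTwo hT
  exact ⟨y, h1⟩

theorem leftCode_of_mem_image_tauTwo {n : ℕ} {T : OrdTree} (hT : T ∈ tauTwo '' treesTwo n) :
    ∃ y, leftCode T = true :: false :: true :: false :: y := by
  obtain ⟨T, hT, rfl⟩ := hT
  obtain ⟨s, s', t, y, -, h', -, -, h2⟩ := exists_of_mem_treesTwo hT
  rw [h']
  exact ⟨y, h2⟩

theorem tauOne_injOn (n : ℕ) : Set.InjOn tauOne (treesOne n) := by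
  rintro _ ⟨-, -, t, rfl⟩ _ ⟨-, -, t', rfl⟩ h
  simpa [tauOne] using h

theorem tauTwo_injOn (n : ℕ) : Set.InjOn tauTwo (treesTwo n) := by
  intro T hT T' hT' e
  obtain ⟨s, r, t, y, rfl, h1, -, h2, h3⟩ := exists_of_mem_treesTwo hT
  obtain ⟨s', r', t', y', rfl, h1', -, h2', h3'⟩ := exists_of_mem_treesTwo hT'
  rw [h1, h1'] at e
  obtain ⟨rfl, rfl⟩ := OrdTree.graft.inj e
  rw [h3] at h3'
  obtain rfl : y = y' := by simpa using h3'
  rw [f_h_injective (h2.trans h2'.symm : (fun s => f (h s)) s = (fun s => f (h s)) s')]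

/-- `T'` arises from `T` by one of the two tree transformations. -/
def IsTauPair (n : ℕ) (T T' : OrdTree) : Prop :=
  (T ∈ treesOne n ∧ T' = tauOne T) ∨ (T ∈ treesTwo n ∧ T' = tauTwo T)

theorem IsTauPair.edges {n : ℕ} {T T' : OrdTree} (hT : IsTauPair n T T') :
    T.edges = n ∧ T'.edges = n := by
  rcases hT with ⟨hT, rfl⟩ | ⟨hT, rfl⟩
  · obtain ⟨h1, -, t, rfl⟩ := hT
    refine ⟨h1, ?_⟩
    rw [← h1]
    simp [tauOne, OrdTree.edges]
    ring
  · obtain ⟨s, s', t, y, -, -, h, -⟩ := exists_of_mem_treesTwo hT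
    exact ⟨hT.1, h⟩

theorem IsTauPair.isFlippableHeads {n : ℕ} {T T' : OrdTree} (hT : IsTauPair n T T') :
    IsFlippableHeads n n (h T) (h T') := by
  have hl := length_h T
  rw [hT.edges.1] at hl
  rcases hT with ⟨hT, rfl⟩ | ⟨hT, rfl⟩
  · obtain ⟨h1, -, t, rfl⟩ := hT
    refine isFlippableHeads_four.append (walk_h t) ?_ rfl (by omega)
    simp [h] at hl
    omega
  · obtain ⟨s, s', t, y, hst, h', -, h1, h2⟩ := exists_of_mem_treesTwo hT
    rw [h', hst]
    rw [hst] at hl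
    have hy : Walk 0 y 0 := by
      have := (walk_h s).f
      rw [h1] at this
      simpa using this
    have hsl := congrArg List.length h1
    rw [length_f, length_h] at hsl
    -- The base pair is extended by y to the codes of the leftmost subtrees, wrapped once, and
    -- extended by h(t).
    have key := (isFlippableHeads_four.append (n := s.edges) (k := s.edges) hy (by
      simp at hsl
      omega) rfl (by omega)).wrap.append (walk_h t) (n := n) (k := n) (by
        simp [h] at hl
        have := length_h s
        omega) (by omega) (by omega)
    have e (r : OrdTree) : h (graft r t) = true :: revBar (f (h r)) ++ [false] ++ h t := by
      simp [h, f]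
    rw [e, e, h1, h2]
    exact key

theorem IsTauPair.ne {n : ℕ} {T T' : OrdTree} (hT : IsTauPair n T T') : T ≠ T' := by
  rintro rfl
  rcases hT with ⟨hT, h⟩ | ⟨hT, h⟩
  · have h1 := leftCode_of_mem_treesOne hT
    have h2 := leftCode_of_mem_image_tauOne ⟨T, hT, h.symm⟩
    simp [h1] at h2
  · obtain ⟨y, h1⟩ := leftCode_of_mem_treesTwo hT
    obtain ⟨z, h2⟩ := leftCode_of_mem_image_tauTwo ⟨T, hT, h.symm⟩
    simp [h1] at h2

/-! ### The decision function on trees -/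

section FlipVertex

variable (φ₁ φ₂ : OrdTree → Bool) {n : ℕ}

theorem isFlipVertex_of_mem_treesOne {T : OrdTree} (hT : T ∈ treesOne n) :
    isFlipVertex φ₁ φ₂ n (h T) = φ₁ T := by
  rw [isFlipVertex, hInv_h hT.1]
  simp only [if_pos hT]

theorem isFlipVertex_tauOne {T : OrdTree} (hT : T ∈ treesOne n) :
    isFlipVertex φ₁ φ₂ n (h (tauOne T)) = φ₁ T := by
  have hi : tauOne T ∈ tauOne '' treesOne n := ⟨T, hT, rfl⟩
  have h1 : tauOne T ∉ treesOne n := fun h' => by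
    have := leftCode_of_mem_image_tauOne hi
    simp [leftCode_of_mem_treesOne h'] at this
  have he : (tauOne T).edges = n := (IsTauPair.edges (.inl ⟨hT, rfl⟩)).2
  rw [isFlipVertex, hInv_h he]
  simp only [if_neg h1, if_pos hi]
  rw [(tauOne_injOn n).leftInvOn_invFunOn hT]

theorem isFlipVertex_of_mem_treesTwo {T : OrdTree} (hT : T ∈ treesTwo n) :
    isFlipVertex φ₁ φ₂ n (h T) = φ₂ T := by
  obtain ⟨y, hy⟩ := leftCode_of_mem_treesTwo hT
  have h1 : T ∉ treesOne n := fun h' => by simp [leftCode_of_mem_treesOne h'] at hy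
  have h2 : T ∉ tauOne '' treesOne n := fun h' => by
    simp [leftCode_of_mem_image_tauOne h'] at hy
  rw [isFlipVertex, hInv_h hT.1]
  simp only [if_neg h1, if_neg h2, if_pos hT]

/-- The prefix 1010 of the code keeps `tauTwo T` out of the three classes tested earlier, and
injectivity of `tauTwo` recovers `T`. -/
theorem isFlipVertex_tauTwo {T : OrdTree} (hT : T ∈ treesTwo n) :
    isFlipVertex φ₁ φ₂ n (h (tauTwo T)) = φ₂ T := by
  have hi : tauTwo T ∈ tauTwo '' treesTwo n := ⟨T, hT, rfl⟩
  obtain ⟨y, hy⟩ := leftCode_of_mem_image_tauTwo hi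
  have h1 : tauTwo T ∉ treesOne n := fun h' => by simp [leftCode_of_mem_treesOne h'] at hy
  have h2 : tauTwo T ∉ tauOne '' treesOne n := fun h' => by
    simp [leftCode_of_mem_image_tauOne h'] at hy
  have h3 : tauTwo T ∉ treesTwo n := fun h' => by
    obtain ⟨z, hz⟩ := leftCode_of_mem_treesTwo h'
    simp [hz] at hy
  have he : (tauTwo T).edges = n := (IsTauPair.edges (.inr ⟨hT, rfl⟩)).2
  rw [isFlipVertex, hInv_h he]
  simp only [if_neg h1, if_neg h2, if_neg h3, if_pos hi]
  rw [(tauTwo_injOn n).leftInvOn_invFunOn hT]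

theorem isFlipVertex_eq_false {T : OrdTree} (he : T.edges = n)
    (h0 : ∀ T', ¬ IsTauPair n T T' ∧ ¬ IsTauPair n T' T) :
    isFlipVertex φ₁ φ₂ n (h T) = false := by
  have h1 : T ∉ treesOne n := fun h' => (h0 _).1 (.inl ⟨h', rfl⟩)
  have h2 : T ∉ tauOne '' treesOne n := fun ⟨S, h', e⟩ => (h0 S).2 (.inl ⟨h', e.symm⟩)
  have h3 : T ∉ treesTwo n := fun h' => (h0 _).1 (.inr ⟨h', rfl⟩)
  have h4 : T ∉ tauTwo '' treesTwo n := fun ⟨S, h', e⟩ => (h0 S).2 (.inr ⟨h', e.symm⟩)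
  rw [isFlipVertex, hInv_h he]
  simp only [if_neg h1, if_neg h2, if_neg h3, if_neg h4]

theorem IsTauPair.isFlipVertex_eq {T T' : OrdTree} (hT : IsTauPair n T T') :
    isFlipVertex φ₁ φ₂ n (h T) = isFlipVertex φ₁ φ₂ n (h T') := by
  rcases hT with ⟨hT, rfl⟩ | ⟨hT, rfl⟩
  · rw [isFlipVertex_of_mem_treesOne _ _ hT, isFlipVertex_tauOne _ _ hT]
  · rw [isFlipVertex_of_mem_treesTwo _ _ hT, isFlipVertex_tauTwo _ _ hT]

/-- If both trees of a candidate pair can only be transformed into each other, then their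
decisions agree. -/
theorem isFlipVertex_eq_of_unique {T T' : OrdTree} (he : T.edges = n) (he' : T'.edges = n)
    (h1 : ∀ S, IsTauPair n T S → S = T') (h2 : ∀ S, ¬ IsTauPair n S T)
    (h3 : ∀ S, IsTauPair n S T' → S = T) (h4 : ∀ S, ¬ IsTauPair n T' S) :
    isFlipVertex φ₁ φ₂ n (h T) = isFlipVertex φ₁ φ₂ n (h T') := by
  by_cases hp : IsTauPair n T T'
  · exact hp.isFlipVertex_eq φ₁ φ₂
  · rw [isFlipVertex_eq_false φ₁ φ₂ he fun S => ⟨fun hS => hp (h1 S hS ▸ hS), h2 S⟩,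
      isFlipVertex_eq_false φ₁ φ₂ he' fun S => ⟨h4 S, fun hS => hp (h3 S hS ▸ hS)⟩]

theorem IsTauPair.leftCode {T T' : OrdTree} (hT : IsTauPair n T T') :
    (leftCode T = [true, false] ∧ leftCode T' = []) ∨
      ∃ y, leftCode T = true :: true :: false :: false :: y ∧
        leftCode T' = true :: false :: true :: false :: y := by
  rcases hT with ⟨hT, rfl⟩ | ⟨hT, rfl⟩
  · exact .inl ⟨leftCode_of_mem_treesOne hT, leftCode_of_mem_image_tauOne ⟨T, hT, rfl⟩⟩
  · obtain ⟨s, s', t, y, hst, h', -, h1, h2⟩ := exists_of_mem_treesTwo hT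
    rw [h', hst]
    exact .inr ⟨y, h1, h2⟩

/-- For n = 2 the set `treesOne n` is empty, so the two trees need not form a transformation pair;
uniqueness of partners then makes both values false. -/
theorem isFlipVertex_eq_of_one (t : OrdTree) (he : t.edges + 2 = n) :
    isFlipVertex φ₁ φ₂ n (h (graft (graft root root) t)) =
      isFlipVertex φ₁ φ₂ n (h (graft root (graft root t))) := by
  have c1 : leftCode (graft (graft root root) t) = [true, false] := rfl
  have c2 : leftCode (graft root (graft root t)) = [] := rfl
  refine isFlipVertex_eq_of_unique φ₁ φ₂ (by simp [OrdTree.edges]; omega)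
    (by simp [OrdTree.edges]; omega) ?_ ?_ ?_ ?_
  · rintro S (⟨-, rfl⟩ | ⟨hS, -⟩)
    · rfl
    · obtain ⟨y, hy⟩ := leftCode_of_mem_treesTwo hS
      simp [c1] at hy
  · intro S hS
    rcases hS.leftCode with ⟨-, h⟩ | ⟨y, -, h⟩ <;> simp [c1] at h
  · rintro S (⟨⟨-, -, r, rfl⟩, e⟩ | ⟨hS, e⟩)
    · obtain rfl : t = r := by simpa [tauOne] using e
      rfl
    · obtain ⟨y, hy⟩ := leftCode_of_mem_image_tauTwo ⟨S, hS, e.symm⟩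
      simp [c2] at hy
  · intro S hS
    rcases hS.leftCode with ⟨h, -⟩ | ⟨y, h, -⟩ <;> simp [c2] at h

/-- No membership in `treesTwo n` has to be established. A transformation of one tree must have
codes of this form, and injectivity of f∘h then identifies its partner. -/
theorem isFlipVertex_eq_of_two {s s' t : OrdTree} {y : List Bool}
    (he : (graft s t).edges = n) (he' : (graft s' t).edges = n)
    (h1 : f (h s) = true :: true :: false :: false :: y)
    (h2 : f (h s') = true :: false :: true :: false :: y) :
    isFlipVertex φ₁ φ₂ n (h (graft s t)) = isFlipVertex φ₁ φ₂ n (h (graft s' t)) := by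
  have c1 : leftCode (graft s t) = true :: true :: false :: false :: y := h1
  have c2 : leftCode (graft s' t) = true :: false :: true :: false :: y := h2
  refine isFlipVertex_eq_of_unique φ₁ φ₂ he he' ?_ ?_ ?_ ?_
  · rintro S (⟨hS, -⟩ | ⟨hS, rfl⟩)
    · simp [leftCode_of_mem_treesOne hS] at c1
    · obtain ⟨r, r', t', z, e, e', -, h3, h4⟩ := exists_of_mem_treesTwo hS
      obtain ⟨rfl, rfl⟩ := OrdTree.graft.inj e
      obtain rfl : y = z := by simpa [h1] using h3
      rw [e', f_h_injective (h4.trans h2.symm : (fun s => f (h s)) r' = (fun s => f (h s)) s')]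
  · intro S hS
    rcases hS.leftCode with ⟨-, h⟩ | ⟨y, -, h⟩ <;> simp [c1] at h
  · rintro S (⟨hS, e⟩ | ⟨hS, e⟩)
    · simp [leftCode_of_mem_image_tauOne ⟨S, hS, e.symm⟩] at c2
    · obtain ⟨r, r', t', z, rfl, e', -, h3, h4⟩ := exists_of_mem_treesTwo hS
      obtain ⟨rfl, rfl⟩ := OrdTree.graft.inj (e.trans e')
      obtain rfl : y = z := by simpa [h2] using h4
      rw [f_h_injective (h3.trans h1.symm : (fun s => f (h s)) r = (fun s => f (h s)) s)]
  · intro S hS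
    rcases hS.leftCode with ⟨h, -⟩ | ⟨y, h, -⟩ <;> simp [c2] at h

/-- A tree whose leftmost subtree has the code of a doubly wrapped path is not transformed. -/
theorem isFlipVertex_eq_false_of_wrap {s t : OrdTree} {z y : List Bool}
    (he : (graft s t).edges = n) (hz : Walk 0 z 0) (hl : 4 ≤ z.length)
    (hs : f (h s) = true :: revBar z ++ false :: y) :
    isFlipVertex φ₁ φ₂ n (h (graft s t)) = false := by
  have hr := hz.revBar
  rw [← length_revBar] at hl
  generalize revBar z = r at hr hl hs
  have c : leftCode (graft s t) = true :: r ++ false :: y := hs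
  match r with
  | [] => simp at hl
  | [_] => simp at hl
  | [_, _] => simp at hl
  -- Three bits of revBar(z) suffice: a code starting with 1100 or 1010 would make them 100 or begin
  -- with 0, and either goes below height 0.
  | a :: b :: d :: r =>
    refine isFlipVertex_eq_false φ₁ φ₂ he fun S => ⟨fun hS => ?_, fun hS => ?_⟩
    · rcases hS.leftCode with ⟨h, -⟩ | ⟨y, h, -⟩
      · simp [c] at h
      · rw [c] at h
        simp at h
        obtain ⟨rfl, rfl, rfl, -⟩ := h
        simp [Walk] at hr
    · rcases hS.leftCode with ⟨-, h⟩ | ⟨y, -, h⟩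
      · simp [c] at h
      · rw [c] at h
        simp at h
        obtain ⟨rfl, rfl, rfl, -⟩ := h
        simp at hr

end FlipVertex

theorem exists_f_h_eq {z : List Bool} (hz : Walk 0 z 0) : ∃ s, f (h s) = z := by
  obtain ⟨s, hs⟩ := exists_h_eq hz.revBar.permPi
  exact ⟨s, by simp [hs, f]⟩

end OrdTree

/-! ### Consistency of the decisions on pairs of first vertices -/

open OrdTree

theorem HeadPair.le_length {x x' : List Bool} (h : HeadPair x x') :
    4 ≤ x.length ∧ 4 ≤ x'.length := by
  induction h with
  | base y => simp
  | base' y => simp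
  | wrap z z' y _ _ _ ih => simp; omega

theorem HeadPair.isFlipVertex_eq {n : ℕ} {x x' : List Bool} (φ₁ φ₂ : OrdTree → Bool)
    (hp : HeadPair x x') (hx : Walk 0 x 0) (hl : x.length = 2 * n) (hl' : x'.length = 2 * n) :
    isFlipVertex φ₁ φ₂ n x = isFlipVertex φ₁ φ₂ n x' := by
  cases hp with
  | base y =>
    obtain ⟨t, rfl⟩ := exists_h_eq (show Walk 0 y 0 by simpa using hx)
    exact isFlipVertex_eq_of_one φ₁ φ₂ t (by simp [length_h] at hl; omega)
  | base' y =>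
    obtain ⟨t, rfl⟩ := exists_h_eq (show Walk 0 y 0 by simpa using hx)
    exact (isFlipVertex_eq_of_one φ₁ φ₂ t (by simp [length_h] at hl; omega)).symm
  | wrap z z' y hp hz hz' =>
    -- The closing 0 of the wrapping starts at height 1, so the tail `y` is a Dyck path and encodes
    -- a tree.
    obtain ⟨u, hu, hy⟩ : ∃ u, Walk u y 0 ∧ u = 0 := by
      obtain ⟨b, h1, h2⟩ := walk_append.1 hx
      rw [walk_true, Nat.zero_add] at h1
      have h3 := h1.height
      have h4 := hz.revBar.height
      obtain rfl : b = 1 := by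
        push_cast at h3 h4
        omega
      exact ⟨0, by simpa [Walk] using h2, rfl⟩
    subst hy
    obtain ⟨t, rfl⟩ := exists_h_eq hu
    obtain ⟨s, hs⟩ := exists_f_h_eq hz
    obtain ⟨s', hs'⟩ := exists_f_h_eq hz'
    have e (r : OrdTree) : true :: revBar (f (h r)) ++ false :: h t = h (graft r t) := by
      simp [h, f]
    rw [← hs, e] at hl ⊢
    rw [← hs', e] at hl' ⊢
    have he : (graft s t).edges = n := by rw [length_h] at hl; omega
    have he' : (graft s' t).edges = n := by rw [length_h] at hl'; omega
    -- The inner pair consists of the codes of the two leftmost subtrees: a base pair matches the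
    -- second transformation in one direction or the other, and a further wrapping admits no
    -- transformation.
    cases hp with
    | base y => exact isFlipVertex_eq_of_two φ₁ φ₂ he he' hs hs'
    | base' y => exact (isFlipVertex_eq_of_two φ₁ φ₂ he' he hs' hs).symm
    | wrap w w' y hp hw hw' =>
      rw [isFlipVertex_eq_false_of_wrap φ₁ φ₂ he hw hp.le_length.1 hs,
        isFlipVertex_eq_false_of_wrap φ₁ φ₂ he' hw' hp.le_length.2 hs']

end MiddleLevels

theorem lemma3 (n : ℕ) (hn : 1 ≤ n)
    (isFlipTree₁ isFlipTree₂ : MiddleLevels.OrdTree → Bool) :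
    (∀ x ∈ MiddleLevels.DZero (2 * n) n,
      MiddleLevels.isFlipVertex isFlipTree₁ isFlipTree₂ n x = true →
      ∃ x' ∈ MiddleLevels.DZero (2 * n) n,
        x' ≠ x ∧
        MiddleLevels.isFlipVertex isFlipTree₁ isFlipTree₂ n x' = true ∧
        ∃ P ∈ MiddleLevels.paths n n, ∃ P' ∈ MiddleLevels.paths n n,
          P.head? = some x ∧ P'.head? = some x' ∧
          (P, P') ∈ MiddleLevels.flippablePairs n n ∧
          ∃ R ∈ MiddleLevels.flippedPaths n n, ∃ R' ∈ MiddleLevels.flippedPaths n n,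
            MiddleLevels.IsFlippedPair (2 * n) n P P' R R') ∧
    (∀ P P' : MiddleLevels.OPath, (P, P') ∈ MiddleLevels.flippablePairs n n →
      ∀ x x' : List Bool, P.head? = some x → P'.head? = some x' →
        MiddleLevels.isFlipVertex isFlipTree₁ isFlipTree₂ n x =
          MiddleLevels.isFlipVertex isFlipTree₁ isFlipTree₂ n x') := by
  open MiddleLevels OrdTree in
  constructor
  · intro x hx hflip
    obtain ⟨hl, hw⟩ := mem_DZero_iff.1 hx
    obtain ⟨T, rfl⟩ := exists_h_eq hw
    have he : T.edges = n := by rw [length_h] at hl; omega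
    -- The value true can only come from a transformation, with `T` on one of its two sides.
    obtain ⟨T', hT'⟩ : ∃ T', IsTauPair n T T' ∨ IsTauPair n T' T := by
      by_contra! h0
      simp [isFlipVertex_eq_false isFlipTree₁ isFlipTree₂ he h0] at hflip
    have he' : T'.edges = n := hT'.elim (fun h => h.edges.2) (fun h => h.edges.1)
    have hh : IsFlippableHeads n n (h T) (h T') :=
      hT'.elim (fun h => h.isFlippableHeads) (fun h => h.isFlippableHeads.symm)
    obtain ⟨P, P', R, R', hF, hP, hP'⟩ := hh
    refine ⟨h T', mem_DZero_iff.2 ⟨by rw [length_h, he'], walk_h T'⟩, ?_, ?_, P, hF.left_mem,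
      P', hF.right_mem, hP, hP', ⟨R, R', hF⟩, R, ⟨P, P', R', hF⟩, R', ⟨P', P, R, hF.symm⟩,
      hF.isFlippedPair⟩
    · exact h_injective.ne (hT'.elim (fun h => h.ne.symm) (fun h => h.ne))
    · rw [← hflip]
      exact hT'.elim (fun h => (h.isFlipVertex_eq _ _).symm) (fun h => h.isFlipVertex_eq _ _)
  · rintro P P' ⟨R, R', hF⟩ x x' hx hx'
    have h1 := walk_head hF.left_mem hx
    have h2 := walk_head hF.right_mem hx'
    exact (hF.headPair hx hx').isFlipVertex_eq _ _ h1.1 h1.2 h2.2
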